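/- Let $(\mathcal X_1,\mathcal X_2,\mathcal Y,Q)$ be a discrete memoryless two-user multiple-access channel (MAC) with finite alphabets and transition law $Q(y|x_1,x_2)$, used with noiseless unit-delay output feedback; logarithms, entropies and divergences are in base $2$. Put $$D_{ub}=\max_{x_1,x_1'\in\mathcal X_1,\;x_2,x_2'\in\mathcal X_2} D_{KL}\big(Q(\cdot|x_1,x_2)\,\|\,Q(\cdot|x_1',x_2')\big),$$ and assume $D_{ub}<\infty$ (for instance, all transition probabilities are positive). An $(M_1,M_2,N)$ variable-length code consists of independent uniform messages $W_i\in\{1,\dots,M_i\}$, encoding functions with $X_{i,t}=e_{i,t}(W_i,Y^{t-1})$, decoding functions $d_t:\mathcal Y^t\to\{1,\dots,M_1\}\times\{1,\dots,M_2\}$, and a stopping time $1\le T\le N$ of the filtration $\mathcal F_t=\sigma(Y^t)$; its error probability is $P_e=P(d_T(Y^T)\ne(W_1,W_2))$. A triplet $(E,R_1,R_2)$ is achievable if there is a fixed $m$ such that for all $\varepsilon\in(0,1)$ and $M\in\mathbb N$ and all sufficiently large $n$ there is a code with $-\frac{\log P_e}{\mathbb E[T]}\ge E-\varepsilon$, $\frac{\log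 M_i}{\mathbb E[T]}\ge R_i-\varepsilon$ and $M_i\ge M$ for $i=1,2$, and $N\le n^m$. The reliability function $E(R_1,R_2)$ is the supremum of all $E$ such that $(E,R_1,R_2)$ is achievable. A rate pair $(R_1,R_2)$ is achievable if there is a fixed $m$ such that for all $\varepsilon\in(0,1)$ and all sufficiently large $n$ there is a code with $P_e\le\varepsilon$, $\frac{\log M_i}{\mathbb E[T]}\ge R_i-\varepsilon$ for $i=1,2$, and $N\le n^m$. Let $\mathcal P_{MAC}^N$ be the set of laws on $\mathcal X_1^N\times\mathcal X_2^N\times\mathcal Y^N$ of the form $$\prod_{\ell=1}^N P_{1,\ell}(x_{1,\ell}|x_1^{\ell-1},y^{\ell-1})\,P_{2,\ell}(x_{2,\ell}|x_2^{\ell-1},y^{\ell-1})\,Q(y_\ell|x_{1,\ell},x_{2,\ell}),$$ let $\mathcal P_{MAC}=\bigcup_N\mathcal P_{MAC}^N$, and let $N_P$ be the number of letters of $P$. For $P\in\mathcal P_{MAC}$ and stopping times $T_1,T_2,T_3$ of $(\mathcal F_t)$ with values in $\{1,\dots,N_P\}$ put $$I^1(P)=\tfrac{1}{\mathbb E[T_1]}\,\mathbb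 E\Big[\sum_{t=1}^{T_1} I(X_1^t;Y_t\,|\,X_2^t,\mathcal F_{t-1})\Big],\qquad I^2(P)=\tfrac{1}{\mathbb E[T_2]}\,\mathbb E\Big[\sum_{t=1}^{T_2} I(X_2^t;Y_t\,|\,X_1^t,\mathcal F_{t-1})\Big],$$ $$I^3(P)=\tfrac{1}{\mathbb E[T_3]}\,\mathbb E\Big[\sum_{t=1}^{T_3} I(X_1^tX_2^t;Y_t\,|\,\mathcal F_{t-1})\Big],$$ where the mutual informations given $\mathcal F_{t-1}$ are those of the conditional law given the realized outputs $Y^{t-1}$. Then for all $R_1,R_2\ge0$ such that $(R_1,R_2)$ is an achievable rate pair or $E(R_1,R_2)>0$, with $R_3=R_1+R_2$, $$E(R_1,R_2)\;\le\;\sup_{P\in\mathcal P_{MAC}}\ \sup_{T:\,T\le N_P}\ \sup_{T_1,T_2,T_3:\,T_i\le T} D_{ub}\,\min_{i\in\{1,2,3\}}\Big\{1-\frac{R_i}{I^i(P)}\Big\},$$ where $T,T_1,T_2,T_3$ range over stopping times of $(\mathcal F_t)$ with values in $\{1,2,\dots\}$, and $R_i/I^i(P)$ is read as $0$ if $R_i=0$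 and as $+\infty$ if $I^i(P)=0<R_i$ (with $0\cdot(-\infty)=0$). -/

import Mathlib

open MeasureTheory Set
open scoped ENNReal

noncomputable section

namespace MACFeedback

/-! ### Finite probability and Shannon information (in bits) -/

/-- Probability of the event `A` under a law `μ` on a finite type. -/
def prob {Ω : Type*} [Fintype Ω] (μ : PMF Ω) (A : Set Ω) : ℝ :=
  ∑ ω, A.indicator (fun ω => (μ ω).toReal) ω

/-- Conditional probability of `B` given `A` (the value `0` when `A` is null; every such value is
multiplied by a zero weight wherever it is used). -/
def condProb {Ω : Type*} [Fintype Ω] (μ : PMF Ω) (B A : Set Ω) : ℝ :=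
  prob μ (B ∩ A) / prob μ A

/-- `H(U | A)`, the Shannon entropy of the random variable `U` under the conditional law given the
event `A`. -/
def entropy {Ω α : Type*} [Fintype Ω] [Fintype α] (μ : PMF Ω) (A : Set Ω) (U : Ω → α) : ℝ :=
  ∑ u, Real.negMulLog (condProb μ (U ⁻¹' {u}) A) / Real.log 2

/-- `H(U | V, A)`, the conditional entropy of `U` given the random variable `V`, under the
conditional law given the event `A`. -/
def condEntropy {Ω α β : Type*} [Fintype Ω] [Fintype α] [Fintype β] (μ : PMF Ω) (A : Set Ω)
    (U : Ω → α) (V : Ω → β) : ℝ :=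
  ∑ v, condProb μ (V ⁻¹' {v}) A * entropy μ (V ⁻¹' {v} ∩ A) U

/-- `I(U ; V | Z, A) = H(V | Z, A) - H(V | U, Z, A)`, the conditional mutual information of `U` and
`V` given the random variable `Z`, under the conditional law given the event `A`. -/
def condMutualInfo {Ω α β γ : Type*} [Fintype Ω] [Fintype α] [Fintype β] [Fintype γ]
    (μ : PMF Ω) (A : Set Ω) (U : Ω → α) (V : Ω → β) (Z : Ω → γ) : ℝ :=
  condEntropy μ A V Z - condEntropy μ A V (fun ω => (U ω, Z ω))

/-- Kullback–Leibler divergence in bits. -/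
def klBits {Y : Type*} (p q : PMF Y) : ℝ≥0∞ :=
  letI : MeasurableSpace Y := ⊤
  InformationTheory.klDiv p.toMeasure q.toMeasure / ENNReal.ofReal (Real.log 2)

/-! ### Stopping times of the output process -/

/-- The filtration of the output sequence `Y_1, …, Y_N`: `ℱ_t` is generated by `Y_1, …, Y_t`.
(The output `Y_t` is stored at index `t - 1` of `Fin N`.) -/
def outputFiltration (Y : Type*) (N : ℕ) :
    Filtration ℕ (⊤ : MeasurableSpace (Fin N → Y)) where
  seq t := MeasurableSpace.comap (fun (y : Fin N → Y) (i : {i : Fin N // (i : ℕ) < t}) => y i) ⊤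
  mono' := by
    intro s t hst
    rintro _ ⟨B, -, rfl⟩
    exact ⟨(fun (z : {i : Fin N // (i : ℕ) < t} → Y) (i : {i : Fin N // (i : ℕ) < s}) =>
      z ⟨i.1, i.2.trans_le hst⟩) ⁻¹' B, trivial, rfl⟩
  le' _ := le_top

/-- A stopping time of the output process with values in `{1, …, N}`. -/
structure StopTime (Y : Type*) (N : ℕ) where
  /-- The stopping time as a function of the output sequence. -/
  time : (Fin N → Y) → ℕ
  one_le : ∀ y, 1 ≤ time y
  le : ∀ y, time y ≤ N
  isStoppingTime : IsStoppingTime (outputFiltration Y N) (fun y => (time y : WithTop ℕ))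

/-- The history `v_1, …, v_k` of a sequence `v_1, …, v_N` strictly before its entry of
index `k : Fin N` (the entry at time `k + 1`). -/
def past {α : Type*} {N : ℕ} (k : Fin N) (v : Fin N → α) : Fin k → α :=
  Fin.take k k.isLt.le v

/-- The history `v_1, …, v_{k+1}` of a sequence up to and including its entry of index `k`. -/
def upto {α : Type*} {N : ℕ} (k : Fin N) (v : Fin N → α) : Fin (k + 1) → α :=
  Fin.take (k + 1) k.isLt v

variable {X₁ X₂ Y : Type*}

/-! ### Variable-length codes and the reliability function.
A discrete memoryless MAC is its transition law `Q : X₁ → X₂ → PMF Y`. -/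

/-- An `(M₁, M₂, N)` variable-length code with feedback. -/
structure VLC (X₁ X₂ Y : Type*) (M₁ M₂ N : ℕ) where
  M₁_pos : 0 < M₁
  M₂_pos : 0 < M₂
  /-- Encoding functions of the first transmitter. -/
  enc₁ : (k : Fin N) → Fin M₁ → (Fin k → Y) → X₁
  /-- Encoding functions of the second transmitter. -/
  enc₂ : (k : Fin N) → Fin M₂ → (Fin k → Y) → X₂
  /-- Decoding functions. -/
  dec : (t : ℕ) → (Fin t → Y) → Fin M₁ × Fin M₂
  /-- The stopping time. -/
  T : StopTime Y N

namespace VLC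

variable {M₁ M₂ N : ℕ}

/-- The joint probability of the messages `w₁, w₂` (independent and uniform) and the channel
outputs `y`. -/
def law (Q : X₁ → X₂ → PMF Y) (C : VLC X₁ X₂ Y M₁ M₂ N) (w₁ : Fin M₁) (w₂ : Fin M₂)
    (y : Fin N → Y) : ℝ :=
  1 / (M₁ : ℝ) * (1 / (M₂ : ℝ)) *
    ∏ k : Fin N, (Q (C.enc₁ k w₁ (past k y)) (C.enc₂ k w₂ (past k y)) (y k)).toReal

/-- The decoded message pair `d_T(Y^T)`. -/
def decoded (C : VLC X₁ X₂ Y M₁ M₂ N) (y : Fin N → Y) : Fin M₁ × Fin M₂ :=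
  C.dec (C.T.time y) (Fin.take (C.T.time y) (C.T.le y) y)

variable [Fintype Y]

/-- The expected transmission time `𝔼[T]`. -/
def expTime (Q : X₁ → X₂ → PMF Y) (C : VLC X₁ X₂ Y M₁ M₂ N) : ℝ :=
  ∑ w₁, ∑ w₂, ∑ y, C.law Q w₁ w₂ y * (C.T.time y : ℝ)

open Classical in
/-- The error probability. -/
def errProb (Q : X₁ → X₂ → PMF Y) (C : VLC X₁ X₂ Y M₁ M₂ N) : ℝ :=
  ∑ w₁, ∑ w₂, ∑ y, if C.decoded y ≠ (w₁, w₂) then C.law Q w₁ w₂ y else 0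

/-- The rate `log₂ M₁ / 𝔼[T]` of the first transmitter. -/
def rate₁ (Q : X₁ → X₂ → PMF Y) (C : VLC X₁ X₂ Y M₁ M₂ N) : ℝ :=
  Real.logb 2 M₁ / C.expTime Q

/-- The rate `log₂ M₂ / 𝔼[T]` of the second transmitter. -/
def rate₂ (Q : X₁ → X₂ → PMF Y) (C : VLC X₁ X₂ Y M₁ M₂ N) : ℝ :=
  Real.logb 2 M₂ / C.expTime Q

open Classical in
/-- The error exponent `- log₂ P_e / 𝔼[T]`, which is `∞` for a code without errors. -/
def errExponent (Q : X₁ → X₂ → PMF Y) (C : VLC X₁ X₂ Y M₁ M₂ N) : EReal :=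
  if C.errProb Q = 0 then ⊤ else ((-Real.logb 2 (C.errProb Q) / C.expTime Q : ℝ) : EReal)

end VLC

/-- Achievability of a triplet `(E, R₁, R₂)` of reliability and rates. -/
def Achievable [Fintype Y] (Q : X₁ → X₂ → PMF Y) (E R₁ R₂ : ℝ) : Prop :=
  ∃ m : ℕ, ∀ ε ∈ Ioo (0 : ℝ) 1, ∀ M : ℕ, ∃ n₀ : ℕ, ∀ n ≥ n₀,
    ∃ (M₁ M₂ N : ℕ) (C : VLC X₁ X₂ Y M₁ M₂ N),
      ((E - ε : ℝ) : EReal) ≤ C.errExponent Q ∧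
      R₁ - ε ≤ C.rate₁ Q ∧ R₂ - ε ≤ C.rate₂ Q ∧
      M ≤ M₁ ∧ M ≤ M₂ ∧ N ≤ n ^ m

/-- The reliability function `E(R₁, R₂)`. -/
def reliability [Fintype Y] (Q : X₁ → X₂ → PMF Y) (R₁ R₂ : ℝ) : EReal :=
  ⨆ (E : ℝ) (_ : Achievable Q E R₁ R₂), (E : EReal)

/-- Achievability of a rate pair, with vanishing error probability. -/
def RateAchievable [Fintype Y] (Q : X₁ → X₂ → PMF Y) (R₁ R₂ : ℝ) : Prop :=
  ∃ m : ℕ, ∀ ε ∈ Ioo (0 : ℝ) 1, ∃ n₀ : ℕ, ∀ n ≥ n₀,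
    ∃ (M₁ M₂ N : ℕ) (C : VLC X₁ X₂ Y M₁ M₂ N),
      C.errProb Q ≤ ε ∧ R₁ - ε ≤ C.rate₁ Q ∧ R₂ - ε ≤ C.rate₂ Q ∧ N ≤ n ^ m

/-! ### Input-output laws and variable-length directed information -/

/-- The sample space of `(X₁^N, X₂^N, Y^N)`. -/
abbrev Paths (X₁ X₂ Y : Type*) (N : ℕ) : Type _ :=
  (Fin N → X₁) × (Fin N → X₂) × (Fin N → Y)

/-- The class `𝒫_MAC^N` of `N`-letter laws that factor as
`∏_ℓ P_{1,ℓ}(x_{1,ℓ} | x₁^{ℓ-1} y^{ℓ-1}) P_{2,ℓ}(x_{2,ℓ} | x₂^{ℓ-1} y^{ℓ-1}) Q(y_ℓ | x_{1,ℓ} x_{2,ℓ})`. -/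
def PMAC (Q : X₁ → X₂ → PMF Y) (N : ℕ) : Set (PMF (Paths X₁ X₂ Y N)) :=
  {P | ∃ (K₁ : (k : Fin N) → (Fin k → X₁) → (Fin k → Y) → PMF X₁)
      (K₂ : (k : Fin N) → (Fin k → X₂) → (Fin k → Y) → PMF X₂),
      ∀ (x₁ : Fin N → X₁) (x₂ : Fin N → X₂) (y : Fin N → Y),
        P (x₁, x₂, y) = ∏ k : Fin N,
          K₁ k (past k x₁) (past k y) (x₁ k) * K₂ k (past k x₂) (past k y) (x₂ k) *
            Q (x₁ k) (x₂ k) (y k)}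

variable [Fintype X₁] [Fintype X₂] [Fintype Y] {N : ℕ}

/-- `𝔼[f]` for a function `f` of the output sequence. -/
def expect (P : PMF (Paths X₁ X₂ Y N)) (f : (Fin N → Y) → ℝ) : ℝ :=
  ∑ ω, (P ω).toReal * f ω.2.2

/-- The event `{Y^{t-1} = y^{t-1}}`, where `t = k + 1`. -/
def pastEvent (k : Fin N) (y : Fin N → Y) : Set (Paths X₁ X₂ Y N) :=
  {ω | past k ω.2.2 = past k y}

/-- `𝔼[∑_{t=1}^{τ} J_t(Y^{t-1})]`, where the time `t` has index `k = t - 1`. -/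
def expectSum (P : PMF (Paths X₁ X₂ Y N)) (τ : StopTime Y N) (J : Fin N → (Fin N → Y) → ℝ) : ℝ :=
  expect P fun y => ∑ k : Fin N, if (k : ℕ) < τ.time y then J k y else 0

/-- `I(X₁^τ → Y^τ ‖ X₂^τ) = 𝔼[∑_{t=1}^τ I(X₁^t ; Y_t | X₂^t, ℱ_{t-1})]`. -/
def directedInfo₁ (P : PMF (Paths X₁ X₂ Y N)) (τ : StopTime Y N) : ℝ :=
  expectSum P τ fun k y =>
    condMutualInfo P (pastEvent k y) (fun ω => upto k ω.1) (fun ω => ω.2.2 k)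
      (fun ω => upto k ω.2.1)

/-- `I(X₂^τ → Y^τ ‖ X₁^τ) = 𝔼[∑_{t=1}^τ I(X₂^t ; Y_t | X₁^t, ℱ_{t-1})]`. -/
def directedInfo₂ (P : PMF (Paths X₁ X₂ Y N)) (τ : StopTime Y N) : ℝ :=
  expectSum P τ fun k y =>
    condMutualInfo P (pastEvent k y) (fun ω => upto k ω.2.1) (fun ω => ω.2.2 k)
      (fun ω => upto k ω.1)

/-- `I(X₁^τ X₂^τ → Y^τ) = 𝔼[∑_{t=1}^τ I(X₁^t X₂^t ; Y_t | ℱ_{t-1})]`. -/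
def directedInfo₃ (P : PMF (Paths X₁ X₂ Y N)) (τ : StopTime Y N) : ℝ :=
  expectSum P τ fun k y =>
    condMutualInfo P (pastEvent k y) (fun ω => (upto k ω.1, upto k ω.2.1)) (fun ω => ω.2.2 k)
      (fun _ => ())

/-- The normalized directed informations `I^i(P)`, `i = 1, 2, 3`, with stopping time `T_i`. -/
def normInfo (P : PMF (Paths X₁ X₂ Y N)) (Ti : Fin 3 → StopTime Y N) : Fin 3 → ℝ :=
  ![directedInfo₁ P (Ti 0) / expect P (fun y => ((Ti 0).time y : ℝ)),
    directedInfo₂ P (Ti 1) / expect P (fun y => ((Ti 1).time y : ℝ)),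
    directedInfo₃ P (Ti 2) / expect P (fun y => ((Ti 2).time y : ℝ))]

/-- The rates `R₁, R₂` and `R₃ = R₁ + R₂`. -/
def rates (R₁ R₂ : ℝ) : Fin 3 → ℝ := ![R₁, R₂, R₁ + R₂]

/-! ### The two-phase upper bound -/

/-- `D_ub`, the largest divergence between two rows of the channel. -/
def Dub (Q : X₁ → X₂ → PMF Y) : ℝ≥0∞ :=
  ⨆ (x₁ : X₁) (x₁' : X₁) (x₂ : X₂) (x₂' : X₂), klBits (Q x₁ x₂) (Q x₁' x₂')

/-- The two-phase bound: the supremum over `N`, over `P ∈ 𝒫_MAC^N`, over stopping times `T ≤ N` and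
`T₁, T₂, T₃ ≤ T` of `D_ub * min_i (1 - R_i / I^i(P))`. The quotient is taken in `[0, ∞]`, so it is
`∞` when `I^i(P) = 0 < R_i`, and `0` when `R_i = 0`. -/
def twoPhaseBound (Q : X₁ → X₂ → PMF Y) (R₁ R₂ : ℝ) : EReal :=
  ⨆ (N : ℕ) (P : PMF (Paths X₁ X₂ Y N)) (_ : P ∈ PMAC Q N) (T : StopTime Y N)
    (Ti : Fin 3 → StopTime Y N) (_ : ∀ i y, (Ti i).time y ≤ T.time y),
    (Dub Q : EReal) * ⨅ i : Fin 3,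
      (1 - ((ENNReal.ofReal (rates R₁ R₂ i) / ENNReal.ofReal (normInfo P Ti i) : ℝ≥0∞) : EReal))

end MACFeedback

end

set_option linter.unusedSectionVars false

/-! Take a code with error probability `Pe` and mean length `A = 𝔼[T]`, and cut it at the first time
`τ` at which some message pair has posterior probability at least `1 - δ`, or at `T` if that comes
first. Write `B = 𝔼[τ]`.

Before `τ` (transmission): the maximum-likelihood estimate at `τ` errs with probability at most `δ +
Pe` (`estimate_error_le`). A Fano inequality for stopped sequences (`fano_stopped`, `fano_directed`,
`VLC.fano`) then bounds the log-sizes of the message sets by the directed informations up to `τ`, so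
`R_i A` is essentially at most the `i`-th directed information.

After `τ` (confirmation): just before `τ` every posterior is at most `1 - δ`, and one output changes
likelihood ratios by a bounded factor because `D_ub` is finite. Hence at `τ` the likelihood of the
true pair against the sum of all others is bounded, while at `T` it must be of order `1 / Pe`. Its
logarithm grows by at most `D_ub` per step on average, by convexity of the divergence. So `log (1 /
Pe)` is essentially at most `D_ub (A - B)` (`confirmation_phase_le`).

Together `E ≲ D_ub (1 - B / A)` and, with `T₁ = T₂ = T₃ = τ`, `R_i / I^i ≲ B / A`. The additive
errors are negligible against `A`, which is forced to be large by large message sets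
(`VLC.log_card_le`); `le_twoPhaseBound_of_approx` passes to the supremum. Nonpositive exponents need
only that the bound is nonnegative, which for achievable rates is Fano with `τ = T`.

All expectations are finite sums over `Y^N`. Different laws are compared at a stopping time by
replacing the factors after it with uniform ones, which does not change sums of stopped functions
(`IsKernel.sum_mul_tailProd_time`). -/

namespace MACFeedback

/-! ### Causal kernels and stopped functions on finite sequences -/

section Kernel

variable {Y : Type*} {N : ℕ}

/-- Two sequences agree in their first `n` entries. -/
def Agree (n : ℕ) (y y' : Fin N → Y) : Prop := ∀ i : Fin N, (i : ℕ) < n → y i = y' i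

lemma Agree.symm {n : ℕ} {y y' : Fin N → Y} (h : Agree n y y') : Agree n y' y :=
  fun i hi => (h i hi).symm

lemma Agree.mono {m n : ℕ} {y y' : Fin N → Y} (hmn : m ≤ n) (h : Agree n y y') : Agree m y y' :=
  fun i hi => h i (hi.trans_le hmn)

/-- `f` is a function of the first `n` entries only. -/
def DependsOnFirst {β : Type*} (n : ℕ) (f : (Fin N → Y) → β) : Prop :=
  ∀ y y', Agree n y y' → f y = f y'

/-- `τ` is determined by the entries up to time `τ`. -/
def IsStop (τ : (Fin N → Y) → ℕ) : Prop := ∀ y y', Agree (τ y) y y' → τ y = τ y'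

/-- `f` is determined by the entries up to time `τ`. -/
def Stopped {β : Type*} (τ : (Fin N → Y) → ℕ) (f : (Fin N → Y) → β) : Prop :=
  ∀ y y', Agree (τ y) y y' → f y = f y'

lemma Stopped.mono {β : Type*} {τ σ : (Fin N → Y) → ℕ} {f : (Fin N → Y) → β}
    (hle : ∀ y, τ y ≤ σ y) (hf : Stopped τ f) : Stopped σ f :=
  fun y y' h => hf y y' (h.mono (hle y))

/-- The slices `{τ = n}` reduce statements about stopped functions to deterministic times. -/
lemma IsStop.dependsOnFirst_ite {τ : (Fin N → Y) → ℕ} (hτ : IsStop τ) {f : (Fin N → Y) → ℝ}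
    (hf : Stopped τ f) (n : ℕ) : DependsOnFirst n (fun y => if τ y = n then f y else 0) := by
  intro y y' h
  by_cases h1 : τ y = n
  · have h2 := hτ y y' (h1 ▸ h)
    simp only [h1, ← h2, if_true]
    exact hf y y' (h1 ▸ h)
  · by_cases h2 : τ y' = n
    · exact absurd ((hτ y' y (h2 ▸ h.symm)).symm.trans h2) h1
    · simp [h1, h2]

lemma IsStop.le_iff {τ : (Fin N → Y) → ℕ} (hτ : IsStop τ) {n : ℕ} {y y' : Fin N → Y}
    (h : Agree n y y') : τ y ≤ n ↔ τ y' ≤ n :=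
  ⟨fun h1 => (hτ y y' (h.mono h1)) ▸ h1, fun h1 => (hτ y' y (h.symm.mono h1)) ▸ h1⟩

lemma agree_update (k : Fin N) (y : Fin N → Y) (a : Y) : Agree k y (Function.update y k a) := by
  intro i hi
  rw [Function.update_of_ne]
  rintro rfl
  exact lt_irrefl _ hi

/-- The product of the first `n` factors. -/
def headProd (c : Fin N → (Fin N → Y) → ℝ) (n : ℕ) (y : Fin N → Y) : ℝ :=
  ∏ k ∈ Finset.univ.filter (fun j : Fin N => (j : ℕ) < n), c k y

/-- The product of the factors of index at least `n`. -/
def tailProd (c : Fin N → (Fin N → Y) → ℝ) (n : ℕ) (y : Fin N → Y) : ℝ :=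
  ∏ k ∈ Finset.univ.filter (fun j : Fin N => ¬ (j : ℕ) < n), c k y

lemma headProd_mul_tailProd (c : Fin N → (Fin N → Y) → ℝ) (n : ℕ) (y : Fin N → Y) :
    headProd c n y * tailProd c n y = ∏ k, c k y :=
  Finset.prod_filter_mul_prod_filter_not _ _ _

lemma headProd_zero (c : Fin N → (Fin N → Y) → ℝ) (y : Fin N → Y) : headProd c 0 y = 1 := by
  simp [headProd]

lemma tailProd_zero (c : Fin N → (Fin N → Y) → ℝ) (y : Fin N → Y) :
    tailProd c 0 y = ∏ k, c k y := by
  simp [tailProd]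

lemma headProd_last (c : Fin N → (Fin N → Y) → ℝ) (y : Fin N → Y) :
    headProd c N y = ∏ k, c k y := by
  simp [headProd]

lemma tailProd_last (c : Fin N → (Fin N → Y) → ℝ) (y : Fin N → Y) : tailProd c N y = 1 := by
  simp [tailProd]

lemma headProd_succ (c : Fin N → (Fin N → Y) → ℝ) (k : Fin N) (y : Fin N → Y) :
    headProd c (k + 1) y = headProd c k y * c k y := by
  have : (Finset.univ.filter fun j : Fin N => (j : ℕ) < k + 1) =
      insert k (Finset.univ.filter fun j : Fin N => (j : ℕ) < k) := by
    ext j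
    simp only [Finset.mem_filter, Finset.mem_univ, true_and, Finset.mem_insert, Fin.ext_iff]
    omega
  rw [headProd, this, Finset.prod_insert (by simp), mul_comm]
  rfl

lemma tailProd_eq_mul (c : Fin N → (Fin N → Y) → ℝ) (k : Fin N) (y : Fin N → Y) :
    tailProd c k y = c k y * tailProd c (k + 1) y := by
  have : (Finset.univ.filter fun j : Fin N => ¬ (j : ℕ) < k) =
      insert k (Finset.univ.filter fun j : Fin N => ¬ (j : ℕ) < k + 1) := by
    ext j
    simp only [Finset.mem_filter, Finset.mem_univ, true_and, Finset.mem_insert, Fin.ext_iff]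
    omega
  rw [tailProd, this, Finset.prod_insert (by simp)]
  rfl

variable [Fintype Y] [DecidableEq Y]

/-- A causal stochastic kernel `c_k(y_k | y_0, …, y_{k-1})`. -/
structure IsKernel (c : Fin N → (Fin N → Y) → ℝ) : Prop where
  nonneg : ∀ k y, 0 ≤ c k y
  adapted : ∀ k : Fin N, DependsOnFirst (k + 1) (c k)
  sum_eq : ∀ (k : Fin N) y, ∑ a, c k (Function.update y k a) = 1

lemma IsKernel.headProd_nonneg {c : Fin N → (Fin N → Y) → ℝ} (hc : IsKernel c) (n : ℕ)
    (y : Fin N → Y) : 0 ≤ headProd c n y :=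
  Finset.prod_nonneg fun k _ => hc.nonneg k y

lemma IsKernel.tailProd_nonneg {c : Fin N → (Fin N → Y) → ℝ} (hc : IsKernel c) (n : ℕ)
    (y : Fin N → Y) : 0 ≤ tailProd c n y :=
  Finset.prod_nonneg fun k _ => hc.nonneg k y

lemma IsKernel.prod_nonneg {c : Fin N → (Fin N → Y) → ℝ} (hc : IsKernel c)
    (y : Fin N → Y) : 0 ≤ ∏ k, c k y :=
  Finset.prod_nonneg fun k _ => hc.nonneg k y

lemma IsKernel.headProd_dep {c : Fin N → (Fin N → Y) → ℝ} (hc : IsKernel c) (n : ℕ) :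
    DependsOnFirst n (headProd c n) := by
  intro y y' h
  refine Finset.prod_congr rfl fun k hk => hc.adapted k y y' (h.mono ?_)
  simpa using hk

lemma IsKernel.stopped_headProd {c : Fin N → (Fin N → Y) → ℝ} (hc : IsKernel c)
    {τ : (Fin N → Y) → ℕ} (hτ : IsStop τ) : Stopped τ (fun y => headProd c (τ y) y) := by
  intro y y' h
  simp only [← hτ y y' h]
  exact hc.headProd_dep _ y y' h

/-- Exchanging the `k`-th entry of `y` with `a` is an involution of the pairs `(y, a)`. -/
lemma sum_sum_update (k : Fin N) (h : (Fin N → Y) → ℝ) :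
    ∑ y, ∑ a, h (Function.update y k a) = Fintype.card Y * ∑ y, h y := by
  have h1 : ∑ p : (Fin N → Y) × Y, h (Function.update p.1 k p.2) =
      ∑ p : (Fin N → Y) × Y, h p.1 :=
    Finset.sum_bij' (fun p _ => (Function.update p.1 k p.2, p.1 k))
      (fun p _ => (Function.update p.1 k p.2, p.1 k)) (by simp) (by simp) (by simp) (by simp)
      (by simp)
  rw [← Fintype.sum_prod_type', h1, Fintype.sum_prod_type]
  simp [Finset.mul_sum]

variable [Nonempty Y]

/-- Conditioning on the first `k` entries does not change the mean. -/
lemma sum_eq_inv_card_mul (k : Fin N) (h : (Fin N → Y) → ℝ) :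
    ∑ y, h y = (Fintype.card Y : ℝ)⁻¹ * ∑ y, ∑ a, h (Function.update y k a) := by
  rw [sum_sum_update, inv_mul_cancel_left₀]
  exact_mod_cast Fintype.card_ne_zero

/-- Both the kernel and the uniform law have total mass one after time `n`, so against a function of
the past one tail is as good as the other. The right side no longer mentions `c`, which is what
makes different kernels comparable. -/
lemma IsKernel.sum_mul_tailProd {c : Fin N → (Fin N → Y) → ℝ} (hc : IsKernel c) {n : ℕ}
    (hn : n ≤ N) {G : (Fin N → Y) → ℝ} (hG : DependsOnFirst n G) :
    ∑ y, G y * tailProd c n y = ∑ y, G y * ((Fintype.card Y : ℝ)⁻¹) ^ (N - n) := by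
  induction hn using Nat.decreasingInduction generalizing G with
  | self => simp [tailProd_last]
  | of_succ n hn ih =>
    have hn' : n < N := hn
    let k : Fin N := ⟨n, hn'⟩
    have hG1 : DependsOnFirst (n + 1) (fun y => G y * c k y) := fun y y' h => by
      have h1 : G y = G y' := hG y y' (h.mono (Nat.le_succ n))
      have h2 : c k y = c k y' := hc.adapted k y y' h
      simp only [h1, h2]
    have h1 : ∑ y, G y * tailProd c n y = ∑ y, (G y * c k y) * tailProd c (n + 1) y :=
      Finset.sum_congr rfl fun y _ => by rw [tailProd_eq_mul c k y, mul_assoc]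
    -- Averaging over entry `n` turns the factor `c k` into one more factor `1 / |Y|`.
    rw [h1, ih hG1, ← Finset.sum_mul, sum_eq_inv_card_mul k, ← Finset.sum_mul]
    have h2 : ∀ y, ∑ a, G (Function.update y k a) * c k (Function.update y k a) = G y := by
      intro y
      have : ∀ a, G (Function.update y k a) = G y := fun a =>
        (hG _ _ (agree_update k y a)).symm
      simp only [this, ← Finset.mul_sum, hc.sum_eq, mul_one]
    simp only [h2]
    have h3 : N - n = N - (n + 1) + 1 := by omega
    rw [h3, pow_succ]
    ring

lemma IsKernel.sum_mul_tailProd_time {c : Fin N → (Fin N → Y) → ℝ} (hc : IsKernel c)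
    {τ : (Fin N → Y) → ℕ} (hτ : IsStop τ) (hN : ∀ y, τ y ≤ N) {G : (Fin N → Y) → ℝ}
    (hG : Stopped τ G) :
    ∑ y, G y * tailProd c (τ y) y = ∑ y, G y * ((Fintype.card Y : ℝ)⁻¹) ^ (N - τ y) := by
  have key : ∀ F : ℕ → (Fin N → Y) → ℝ, ∑ y, G y * F (τ y) y =
      ∑ n ∈ Finset.range (N + 1), ∑ y, (if τ y = n then G y else 0) * F n y := by
    intro F
    rw [Finset.sum_comm]
    refine Finset.sum_congr rfl fun y _ => ?_
    rw [Finset.sum_eq_single (τ y)]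
    · simp
    · intro b _ hb
      simp [Ne.symm hb]
    · intro h
      exact absurd (Finset.mem_range.2 (Nat.lt_succ_of_le (hN y))) h
  rw [key (tailProd c), key (fun n _ => ((Fintype.card Y : ℝ)⁻¹) ^ (N - n))]
  refine Finset.sum_congr rfl fun n hn => ?_
  exact hc.sum_mul_tailProd (Nat.lt_succ_iff.1 (Finset.mem_range.1 hn))
    (hτ.dependsOnFirst_ite hG n)

lemma IsKernel.sum_prod_mul {c : Fin N → (Fin N → Y) → ℝ} (hc : IsKernel c)
    {τ : (Fin N → Y) → ℕ} (hτ : IsStop τ) (hN : ∀ y, τ y ≤ N) {G : (Fin N → Y) → ℝ}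
    (hG : Stopped τ G) :
    ∑ y, (∏ k, c k y) * G y =
      ∑ y, ((Fintype.card Y : ℝ)⁻¹) ^ (N - τ y) * (headProd c (τ y) y * G y) := by
  have h1 : Stopped τ (fun y => headProd c (τ y) y * G y) := fun y y' h => by
    have h2 := hc.stopped_headProd hτ y y' h
    simp only at h2 ⊢
    rw [h2, hG y y' h]
  have h3 := hc.sum_mul_tailProd_time hτ hN h1
  rw [Finset.sum_congr rfl fun y _ => mul_comm _ (headProd c (τ y) y * G y), ← h3]
  refine Finset.sum_congr rfl fun y _ => ?_
  rw [← headProd_mul_tailProd c (τ y) y]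
  ring

lemma IsKernel.sum_prod {c : Fin N → (Fin N → Y) → ℝ} (hc : IsKernel c) :
    ∑ y, ∏ k, c k y = 1 := by
  have h := hc.sum_mul_tailProd (Nat.zero_le N) (G := fun _ => 1) (fun _ _ _ => rfl)
  simp only [tailProd_zero, one_mul] at h
  rw [h]
  simp

/-- The one-step conditional mean bound, integrated over the past. -/
lemma IsKernel.sum_mul_tailProd_mul_le {c : Fin N → (Fin N → Y) → ℝ} (hc : IsKernel c)
    (k : Fin N) {H φ : (Fin N → Y) → ℝ} {D : ℝ} (hH : DependsOnFirst k H)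
    (hH0 : ∀ y, 0 ≤ H y) (hφ : DependsOnFirst (k + 1) φ)
    (hD : ∀ y, 0 < H y →
      ∑ a, c k (Function.update y k a) * φ (Function.update y k a) ≤ D) :
    ∑ y, H y * tailProd c k y * φ y ≤ D * ∑ y, H y * tailProd c k y := by
  have hkN : (k : ℕ) + 1 ≤ N := k.isLt
  have hdep : DependsOnFirst (k + 1) (fun y => H y * c k y * φ y) := fun y y' h => by
    have h1 := hH y y' (h.mono (Nat.le_succ _))
    have h2 := hc.adapted k y y' h
    have h3 := hφ y y' h
    simp only [h1, h2, h3]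
  have h1 : ∑ y, H y * tailProd c k y * φ y =
      ∑ y, (H y * c k y * φ y) * tailProd c (k + 1) y :=
    Finset.sum_congr rfl fun y _ => by rw [tailProd_eq_mul c k y]; ring
  rw [h1, hc.sum_mul_tailProd hkN hdep, hc.sum_mul_tailProd k.isLt.le hH, ← Finset.sum_mul,
    ← Finset.sum_mul, sum_eq_inv_card_mul k]
  have h3 : N - (k : ℕ) = N - (k + 1) + 1 := by omega
  have h4 : ∑ y, ∑ a, H (Function.update y k a) * c k (Function.update y k a) *
      φ (Function.update y k a) ≤ ∑ y, D * H y := by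
    refine Finset.sum_le_sum fun y _ => ?_
    have : ∀ a, H (Function.update y k a) = H y := fun a => (hH _ _ (agree_update k y a)).symm
    simp only [this, mul_assoc, ← Finset.mul_sum]
    rcases (hH0 y).eq_or_lt with h0 | h0
    · simp [← h0]
    · rw [mul_comm D]
      exact mul_le_mul_of_nonneg_left (hD y h0) h0.le
  rw [h3, pow_succ, ← Finset.mul_sum] at *
  have hu : (0 : ℝ) ≤ ((Fintype.card Y : ℝ)⁻¹) ^ (N - ((k : ℕ) + 1)) * (Fintype.card Y : ℝ)⁻¹ := by
    positivity
  nlinarith [mul_le_mul_of_nonneg_right h4 hu]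

/-! ### A Fano inequality for stopped sequences -/

variable {A B : Type*} [Fintype A] [Fintype B]

-- Here `a` is the message to be estimated, `b` side information, and `q b` any output law not
-- involving `a`. The proof is the variational bound on relative entropy with test function `log g`,
-- using that `g` sums to at most `|A|` over `a`. The free parameter `θ` replaces the binary entropy
-- of the usual Fano inequality.
open Classical in
lemma fano_stopped [Nonempty A] {p : A → B → Fin N → (Fin N → Y) → ℝ}
    {q : B → Fin N → (Fin N → Y) → ℝ} (hp : ∀ a b, IsKernel (p a b)) (hq : ∀ b, IsKernel (q b))
    (hpq : ∀ a b y, 0 < ∏ k, p a b k y → ∀ k, 0 < q b k y)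
    {τ : (Fin N → Y) → ℕ} (hτ : IsStop τ) (hN : ∀ y, τ y ≤ N)
    {est : (Fin N → Y) → A} (hest : Stopped τ est) {θ : ℝ} (hθ : θ ∈ Ioo (0 : ℝ) 1) :
    ∑ a, ∑ b, ∑ y, (∏ k, p a b k y) *
        (if est y = a then Real.log ((1 - θ) * Fintype.card A) else Real.log θ) ≤
      ∑ a, ∑ b, ∑ y, (∏ k, p a b k y) *
        ∑ k : Fin N, (if (k : ℕ) < τ y then Real.log (p a b k y / q b k y) else 0) := by
  have hA : (0 : ℝ) < Fintype.card A := by exact_mod_cast Fintype.card_pos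
  obtain ⟨hθ0, hθ1⟩ := hθ
  set u : ℝ := (Fintype.card Y : ℝ)⁻¹ with hu
  let g : A → (Fin N → Y) → ℝ := fun a y =>
    if est y = a then (1 - θ) * Fintype.card A else θ
  have hg : ∀ a y, 0 < g a y := fun a y => by
    simp only [g]
    split_ifs
    · exact mul_pos (by linarith) hA
    · exact hθ0
  have hgs : ∀ a, Stopped τ (g a) := fun a y y' h => by simp only [g, hest y y' h]
  -- `log x ≤ x - 1` at `x = g q / p`, with `p` and `q` cut at `τ`. The two correction terms cancel
  -- up to sign after summation.
  have hpt : ∀ a b y, (∏ k, p a b k y) *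
      (if est y = a then Real.log ((1 - θ) * Fintype.card A) else Real.log θ) ≤
      (∏ k, p a b k y) * ∑ k : Fin N, (if (k : ℕ) < τ y then Real.log (p a b k y / q b k y) else 0) +
      ((g a y * headProd (q b) (τ y) y) * tailProd (p a b) (τ y) y - ∏ k, p a b k y) := by
    intro a b y
    have h0 := (hp a b).prod_nonneg y
    rcases h0.eq_or_lt with h | h
    · rw [← h]
      simp only [zero_mul, zero_add, sub_zero]
      exact mul_nonneg (mul_nonneg (hg a y).le ((hq b).headProd_nonneg _ _))
        ((hp a b).tailProd_nonneg _ _)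
    · have hpk : ∀ k, 0 < p a b k y := fun k =>
        lt_of_le_of_ne ((hp a b).nonneg k y) fun hk =>
          h.ne' (Finset.prod_eq_zero (Finset.mem_univ k) hk.symm)
      have hqk := hpq a b y h
      have hhp : 0 < headProd (p a b) (τ y) y := Finset.prod_pos fun k _ => hpk k
      have hhq : 0 < headProd (q b) (τ y) y := Finset.prod_pos fun k _ => hqk k
      have hsum : ∑ k : Fin N, (if (k : ℕ) < τ y then Real.log (p a b k y / q b k y) else 0) =
          Real.log (headProd (p a b) (τ y) y) - Real.log (headProd (q b) (τ y) y) := by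
        rw [← Finset.sum_filter, headProd, headProd, Real.log_prod (fun k _ => (hpk k).ne'),
          Real.log_prod (fun k _ => (hqk k).ne'), ← Finset.sum_sub_distrib]
        exact Finset.sum_congr rfl fun k _ => Real.log_div (hpk k).ne' (hqk k).ne'
      have hlog : (if est y = a then Real.log ((1 - θ) * Fintype.card A) else Real.log θ) =
          Real.log (g a y) := by
        simp only [g]
        split_ifs <;> rfl
      rw [hsum, hlog]
      have hx : 0 < g a y * headProd (q b) (τ y) y / headProd (p a b) (τ y) y :=
        div_pos (mul_pos (hg a y) hhq) hhp
      have h1 := Real.log_le_sub_one_of_pos hx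
      rw [Real.log_div (mul_pos (hg a y) hhq).ne' hhp.ne', Real.log_mul (hg a y).ne' hhq.ne'] at h1
      have h2 := mul_le_mul_of_nonneg_left h1 h0
      have h3 : (∏ k, p a b k y) *
          (g a y * headProd (q b) (τ y) y / headProd (p a b) (τ y) y) =
          g a y * headProd (q b) (τ y) y * tailProd (p a b) (τ y) y := by
        rw [← headProd_mul_tailProd (p a b) (τ y) y]
        field_simp
      linarith
  have hsum1 : ∀ a b, ∑ y, (g a y * headProd (q b) (τ y) y) * tailProd (p a b) (τ y) y =
      ∑ y, g a y * (u ^ (N - τ y) * (headProd (q b) (τ y) y * 1)) := by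
    intro a b
    rw [(hp a b).sum_mul_tailProd_time hτ hN]
    · exact Finset.sum_congr rfl fun y _ => by ring
    · intro y y' h
      have h2 := (hq b).stopped_headProd hτ y y' h
      simp only at h2 ⊢
      rw [h2, hgs a y y' h]
  -- The sum is `(1 - θ)|A| + θ(|A| - 1) = |A| - θ`.
  have hga : ∀ y, ∑ a, g a y ≤ Fintype.card A := by
    intro y
    have h1 : ∀ a, g a y = θ + (if est y = a then (1 - θ) * Fintype.card A - θ else 0) := by
      intro a
      simp only [g]
      split_ifs <;> ring
    simp only [h1, Finset.sum_add_distrib, Finset.sum_ite_eq, Finset.mem_univ, if_true,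
      Finset.sum_const, Finset.card_univ, nsmul_eq_mul]
    linarith
  have htot : ∑ a, ∑ b, ∑ y, (g a y * headProd (q b) (τ y) y) * tailProd (p a b) (τ y) y ≤
      ∑ _a : A, ∑ _b : B, (1 : ℝ) := by
    simp only [hsum1]
    rw [Finset.sum_comm]
    calc ∑ b, ∑ a, ∑ y, g a y * (u ^ (N - τ y) * (headProd (q b) (τ y) y * 1))
        ≤ ∑ _b : B, (Fintype.card A : ℝ) := by
          refine Finset.sum_le_sum fun b _ => ?_
          rw [Finset.sum_comm]
          have h1 := (hq b).sum_prod_mul hτ hN (G := fun _ => (1 : ℝ)) (fun _ _ _ => rfl)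
          simp only [mul_one] at h1
          rw [(hq b).sum_prod] at h1
          calc ∑ y, ∑ a, g a y * (u ^ (N - τ y) * (headProd (q b) (τ y) y * 1))
              ≤ ∑ y, Fintype.card A * (u ^ (N - τ y) * headProd (q b) (τ y) y) := by
                refine Finset.sum_le_sum fun y _ => ?_
                rw [← Finset.sum_mul, mul_one]
                exact mul_le_mul_of_nonneg_right (hga y)
                  (mul_nonneg (by positivity) ((hq b).headProd_nonneg _ _))
            _ = Fintype.card A := by rw [← Finset.mul_sum, ← h1, mul_one]
      _ = _ := by simp [mul_comm]
  have hone : ∑ a, ∑ b, ∑ y, ∏ k, p a b k y = ∑ _a : A, ∑ _b : B, (1 : ℝ) := by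
    simp only [(hp _ _).sum_prod]
  calc _ ≤ _ := Finset.sum_le_sum fun a _ => Finset.sum_le_sum fun b _ =>
        Finset.sum_le_sum fun y _ => hpt a b y
    _ ≤ _ := by
      simp only [Finset.sum_add_distrib, Finset.sum_sub_distrib]
      linarith

end Kernel

/-! ### The confirmation phase -/

section Confirmation

/-- The maximum of a function on a nonempty finite type is attained. -/
lemma exists_argmax {W : Type*} [Finite W] [Nonempty W] :
    ∃ am : (W → ℝ) → W, ∀ (f : W → ℝ) (w : W), f w ≤ f (am f) :=
  ⟨fun f => (Finite.exists_max f).choose, fun f => (Finite.exists_max f).choose_spec⟩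

/-- Convexity of the divergence in its second argument. -/
lemma sum_mul_log_div_mixture_le {Y W : Type*} [Fintype Y] {s : Finset W} {L : W → ℝ}
    {P : Y → ℝ} {r : W → Y → ℝ} {D : ℝ} (hL : ∀ w ∈ s, 0 ≤ L w) (hS : 0 < ∑ w ∈ s, L w)
    (hP : ∀ a, 0 ≤ P a) (hr : ∀ w ∈ s, ∀ a, 0 < P a → 0 < r w a)
    (hD : ∀ w ∈ s, ∑ a, P a * Real.log (P a / r w a) ≤ D) :
    ∑ a, P a * Real.log (P a * (∑ w ∈ s, L w) / ∑ w ∈ s, L w * r w a) ≤ D := by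
  set S := ∑ w ∈ s, L w with hSdef
  have hpt : ∀ a, P a * Real.log (P a * S / ∑ w ∈ s, L w * r w a) ≤
      ∑ w ∈ s, L w / S * (P a * Real.log (P a / r w a)) := by
    intro a
    rcases (hP a).eq_or_lt with h | h
    · simp [← h]
    · have hm : 0 < ∑ w ∈ s, L w * r w a := by
        obtain ⟨w, hw, hw0⟩ : ∃ w ∈ s, L w ≠ 0 := by
          by_contra! hcon
          exact hS.ne' (Finset.sum_eq_zero hcon)
        exact Finset.sum_pos' (fun v hv => mul_nonneg (hL v hv) (hr v hv a h).le)
          ⟨w, hw, mul_pos (lt_of_le_of_ne (hL w hw) hw0.symm) (hr w hw a h)⟩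
      set m := ∑ w ∈ s, L w * r w a with hmdef
      have h1 : ∀ w ∈ s, L w / S * (P a * (Real.log (P a * S / m))) -
          L w / S * (P a * Real.log (P a / r w a)) ≤
          P a * (L w * r w a / m - L w / S) := by
        intro w hw
        have hrw := hr w hw a h
        have h2 := Real.log_le_sub_one_of_pos (div_pos (mul_pos hS hrw) hm)
        have h3 : Real.log (P a * S / m) - Real.log (P a / r w a) = Real.log (S * r w a / m) := by
          rw [Real.log_div (by positivity) hm.ne', Real.log_div h.ne' hrw.ne',
            Real.log_mul h.ne' hS.ne', Real.log_div (by positivity) hm.ne',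
            Real.log_mul hS.ne' hrw.ne']
          ring
        have h4 : 0 ≤ L w / S * P a := mul_nonneg (div_nonneg (hL w hw) hS.le) h.le
        calc _ = L w / S * P a * (Real.log (P a * S / m) - Real.log (P a / r w a)) := by ring
          _ ≤ L w / S * P a * (S * r w a / m - 1) := by
            rw [h3]
            exact mul_le_mul_of_nonneg_left h2 h4
          _ = _ := by field_simp
      have h5 := Finset.sum_le_sum h1
      rw [Finset.sum_sub_distrib, ← Finset.mul_sum, Finset.sum_sub_distrib, ← Finset.sum_div,
        ← Finset.sum_div, ← hmdef, ← hSdef, div_self hm.ne', div_self hS.ne', sub_self, mul_zero,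
        ← Finset.sum_mul, ← Finset.sum_div, ← hSdef, div_self hS.ne', one_mul] at h5
      linarith
  calc _ ≤ ∑ a, ∑ w ∈ s, L w / S * (P a * Real.log (P a / r w a)) :=
        Finset.sum_le_sum fun a _ => hpt a
    _ = ∑ w ∈ s, L w / S * ∑ a, P a * Real.log (P a / r w a) := by
        rw [Finset.sum_comm]
        simp only [Finset.mul_sum]
    _ ≤ ∑ w ∈ s, L w / S * D := Finset.sum_le_sum fun w hw =>
        mul_le_mul_of_nonneg_left (hD w hw) (div_nonneg (hL w hw) hS.le)
    _ = D := by rw [← Finset.sum_mul, ← Finset.sum_div, div_self hS.ne', one_mul]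

/-- Telescoping with random limits `a`, `b`, kept as an indicator inside a sum over all of `Fin N`
so that sums over time and over outputs can be exchanged. -/
lemma sum_ite_telescope (F : ℕ → ℝ) {a b N : ℕ} (hab : a ≤ b) (hb : b ≤ N) :
    ∑ k : Fin N, (if a ≤ (k : ℕ) ∧ (k : ℕ) < b then F (k + 1) - F k else 0) = F b - F a := by
  rw [Fin.sum_univ_eq_sum_range (fun k => if a ≤ k ∧ k < b then F (k + 1) - F k else 0) N,
    ← Finset.sum_filter]
  have : (Finset.range N).filter (fun k => a ≤ k ∧ k < b) = Finset.Ico a b := by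
    ext k
    simp only [Finset.mem_filter, Finset.mem_range, Finset.mem_Ico]
    omega
  rw [this, Finset.sum_Ico_eq_sub _ hab, Finset.sum_range_sub, Finset.sum_range_sub]
  ring

variable {Y W : Type*} {N : ℕ} [Fintype W] [DecidableEq W]

/-- The total likelihood of the messages other than `w` after `n` outputs. -/
def restSum (c : W → Fin N → (Fin N → Y) → ℝ) (w : W) (n : ℕ) (y : Fin N → Y) : ℝ :=
  ∑ w' ∈ Finset.univ.erase w, headProd (c w') n y

lemma headProd_add_restSum (c : W → Fin N → (Fin N → Y) → ℝ) (w : W) (n : ℕ) (y : Fin N → Y) :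
    headProd (c w) n y + restSum c w n y = ∑ w', headProd (c w') n y :=
  Finset.add_sum_erase _ (fun w' => headProd (c w') n y) (Finset.mem_univ w)

variable [Fintype Y] [DecidableEq Y]

lemma restSum_nonneg {c : W → Fin N → (Fin N → Y) → ℝ} (hc : ∀ w, IsKernel (c w)) (w : W) (n : ℕ)
    (y : Fin N → Y) : 0 ≤ restSum c w n y :=
  Finset.sum_nonneg fun w' _ => (hc w').headProd_nonneg _ _

lemma restSum_dep {c : W → Fin N → (Fin N → Y) → ℝ} (hc : ∀ w, IsKernel (c w)) (w : W) (n : ℕ) :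
    DependsOnFirst n (restSum c w n) :=
  fun y y' h => Finset.sum_congr rfl fun w' _ => (hc w').headProd_dep n y y' h

variable [Nonempty Y]

/-- The stopped estimate `est` errs at most as often as the decoder `dec`, up to `δ`. -/
lemma estimate_error_le {c : W → Fin N → (Fin N → Y) → ℝ} (hc : ∀ w, IsKernel (c w))
    {τ T : (Fin N → Y) → ℕ} (hτ : IsStop τ) (hT : IsStop T) (hle : ∀ y, τ y ≤ T y)
    (hN : ∀ y, T y ≤ N) {est dec : (Fin N → Y) → W} (hest : Stopped τ est) (hdec : Stopped T dec)
    {δ : ℝ} (hδ : 0 ≤ δ)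
    (hgood : ∀ y, (1 - δ) * ∑ w, headProd (c w) (τ y) y ≤ headProd (c (est y)) (τ y) y ∨
      (τ y = T y ∧ ∀ w, headProd (c w) (τ y) y ≤ headProd (c (est y)) (τ y) y)) :
    ∑ w, ∑ y, (∏ k, c w k y) * (if est y = w then 0 else 1) ≤
      δ * Fintype.card W + ∑ w, ∑ y, (∏ k, c w k y) * (if dec y = w then 0 else 1) := by
  set u : ℝ := (Fintype.card Y : ℝ)⁻¹ with hu
  have hu0 : 0 ≤ u := by positivity
  have h1 : ∀ w, ∑ y, (∏ k, c w k y) * (if est y = w then (0 : ℝ) else 1) =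
      ∑ y, u ^ (N - τ y) * (headProd (c w) (τ y) y * (if est y = w then 0 else 1)) := fun w =>
    (hc w).sum_prod_mul hτ (fun y => (hle y).trans (hN y)) fun y y' h => by simp [hest y y' h]
  have h2 : ∀ w, ∑ y, (∏ k, c w k y) * (if dec y = w then (0 : ℝ) else 1) =
      ∑ y, u ^ (N - T y) * (headProd (c w) (T y) y * (if dec y = w then 0 else 1)) := fun w =>
    (hc w).sum_prod_mul hT hN fun y y' h => by simp [hdec y y' h]
  have h3 : ∀ w, (1 : ℝ) = ∑ y, u ^ (N - τ y) * (headProd (c w) (τ y) y * 1) := fun w => by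
    rw [← (hc w).sum_prod_mul hτ (fun y => (hle y).trans (hN y)) fun y y' h => rfl]
    simp [(hc w).sum_prod]
  have h4 : (Fintype.card W : ℝ) = ∑ y, u ^ (N - τ y) * ∑ w, headProd (c w) (τ y) y := by
    calc (Fintype.card W : ℝ) = ∑ _w : W, (1 : ℝ) := by simp
      _ = ∑ w, ∑ y, u ^ (N - τ y) * (headProd (c w) (τ y) y * 1) :=
        Finset.sum_congr rfl fun w _ => h3 w
      _ = _ := by
        rw [Finset.sum_comm]
        simp only [Finset.mul_sum, mul_one]
  have hoff : ∀ (f : W → ℝ) (v : W), ∑ w, f w * (if v = w then (0 : ℝ) else 1) =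
      ∑ w, f w - f v := by
    intro f v
    have : ∀ w, f w * (if v = w then (0 : ℝ) else 1) = f w - (if v = w then f w else 0) := by
      intro w
      split_ifs <;> simp
    simp [this, Finset.sum_sub_distrib]
  simp only [h1, h2]
  rw [Finset.sum_comm, h4, Finset.mul_sum, Finset.sum_comm (s := Finset.univ (α := W)),
    ← Finset.sum_add_distrib]
  refine Finset.sum_le_sum fun y _ => ?_
  rw [← Finset.mul_sum, ← Finset.mul_sum, hoff, hoff]
  have hA : 0 ≤ u ^ (N - τ y) * ∑ w, headProd (c w) (τ y) y :=
    mul_nonneg (by positivity) (Finset.sum_nonneg fun w _ => (hc w).headProd_nonneg _ _)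
  -- With uniform tails the comparison is made for each `y` separately. Either the estimate has
  -- posterior at least `1 - δ`, or `τ = T` and maximum likelihood is at least as good as the
  -- decoder.
  rcases hgood y with h | ⟨h, hmax⟩
  · have hB : 0 ≤ ∑ w, headProd (c w) (T y) y - headProd (c (dec y)) (T y) y := by
      rw [← headProd_add_restSum c (dec y)]
      linarith [restSum_nonneg hc (dec y) (T y) y]
    have hB' := mul_nonneg (pow_nonneg hu0 (N - T y)) hB
    have := mul_le_mul_of_nonneg_left h (pow_nonneg hu0 (N - τ y))
    nlinarith
  · rw [← h]
    have := mul_le_mul_of_nonneg_left (hmax (dec y)) (pow_nonneg hu0 (N - τ y))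
    nlinarith [mul_nonneg hδ hA]

open Classical in
/-- The end of the transmission phase: the first time some message has posterior probability at
least `1 - δ`. -/
lemma exists_transmission_phase [Nonempty W] (hW : 2 ≤ Fintype.card W)
    {c : W → Fin N → (Fin N → Y) → ℝ} (hc : ∀ w, IsKernel (c w)) {lam : ℝ} (hlam : 0 < lam)
    (hratio : ∀ w w' k y, lam * c w k y ≤ c w' k y) {T : (Fin N → Y) → ℕ} (hT : IsStop T)
    (hT1 : ∀ y, 1 ≤ T y) (hN : ∀ y, T y ≤ N) {δ : ℝ} (hδ : 0 < δ) (hδ2 : δ ≤ 1 / 2) :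
    ∃ (τ : (Fin N → Y) → ℕ) (est : (Fin N → Y) → W), IsStop τ ∧ (∀ y, 1 ≤ τ y) ∧
      (∀ y, τ y ≤ T y) ∧ Stopped τ est ∧
      (∀ y, (1 - δ) * ∑ w, headProd (c w) (τ y) y ≤ headProd (c (est y)) (τ y) y ∨
        (τ y = T y ∧ ∀ w, headProd (c w) (τ y) y ≤ headProd (c (est y)) (τ y) y)) ∧
      ∀ w y, lam * δ * headProd (c w) (τ y) y ≤ restSum c w (τ y) y := by
  obtain ⟨am, ham⟩ := exists_argmax (W := W)
  -- Under uniform messages, posterior at least `1 - δ` means that one likelihood carries that share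
  -- of the total. Testing `T y ≤ n` as well makes the search stop by time `T`.
  let P : (Fin N → Y) → ℕ → Prop := fun y n =>
    1 ≤ n ∧ (T y ≤ n ∨ ∃ w, (1 - δ) * ∑ w', headProd (c w') n y ≤ headProd (c w) n y)
  have hP : ∀ y, ∃ n, P y n := fun y => ⟨T y, hT1 y, Or.inl le_rfl⟩
  have hPcongr : ∀ n y y', Agree n y y' → (P y n ↔ P y' n) := by
    intro n y y' h
    have h1 : ∀ w, headProd (c w) n y = headProd (c w) n y' := fun w => (hc w).headProd_dep n y y' h
    simp only [P, h1, hT.le_iff h]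
  let τ : (Fin N → Y) → ℕ := fun y => Nat.find (hP y)
  have hτ : IsStop τ := by
    intro y y' h
    refine ((Nat.find_eq_iff (hP y')).2 ⟨(hPcongr _ y y' h).1 (Nat.find_spec (hP y)), ?_⟩).symm
    intro n hn
    rw [← hPcongr n y y' (h.mono hn.le)]
    exact Nat.find_min (hP y) hn
  have hτT : ∀ y, τ y ≤ T y := fun y => Nat.find_min' (hP y) ⟨hT1 y, Or.inl le_rfl⟩
  refine ⟨τ, fun y => am fun w => headProd (c w) (τ y) y, hτ, fun y => (Nat.find_spec (hP y)).1,
    hτT, ?_, ?_, ?_⟩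
  · intro y y' h
    have h1 : (fun w => headProd (c w) (τ y) y) = fun w => headProd (c w) (τ y') y' :=
      funext fun w => (hc w).stopped_headProd hτ y y' h
    simp only [h1]
  · intro y
    rcases (Nat.find_spec (hP y)).2 with h | ⟨w, h⟩
    · exact Or.inr ⟨le_antisymm (hτT y) h, ham fun w => headProd (c w) (τ y) y⟩
    · exact Or.inl (h.trans (ham (fun w => headProd (c w) (τ y) y) w))
  · intro w y
    have h1 : 1 ≤ τ y := (Nat.find_spec (hP y)).1
    have h2 : τ y - 1 < N := by have := hτT y; have := hN y; omega
    let k : Fin N := ⟨τ y - 1, h2⟩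
    have hk : τ y = (k : ℕ) + 1 := by simp only [k]; omega
    -- One step before `τ`. At time `0` all likelihoods are `1` and at least one other message
    -- exists; later, minimality of `τ` keeps the posterior of `w` below `1 - δ`.
    have hstep : δ * headProd (c w) k y ≤ restSum c w k y := by
      rcases Nat.eq_zero_or_pos (k : ℕ) with h0 | h0
      · rw [h0]
        simp only [restSum, headProd_zero, Finset.sum_const, nsmul_eq_mul, mul_one]
        rw [Finset.card_erase_of_mem (Finset.mem_univ w), Finset.card_univ]
        have : (1 : ℝ) ≤ ((Fintype.card W - 1 : ℕ) : ℝ) := by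
          exact_mod_cast (by omega : 1 ≤ Fintype.card W - 1)
        linarith
      · have hmin : ¬ P y k := Nat.find_min (hP y) (by change (k : ℕ) < τ y; omega)
        have h3 : ¬ (1 - δ) * ∑ w', headProd (c w') k y ≤ headProd (c w) k y := fun h =>
          hmin ⟨h0, Or.inr ⟨w, h⟩⟩
        rw [← headProd_add_restSum c w] at h3
        nlinarith [restSum_nonneg hc w k y, (hc w).headProd_nonneg k y]
    -- The jump at time `τ` costs only a factor `lam` by the likelihood-ratio bound.
    have hrest : lam * c w k y * restSum c w k y ≤ restSum c w (k + 1) y := by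
      rw [restSum, restSum, Finset.mul_sum]
      refine Finset.sum_le_sum fun w' _ => ?_
      rw [headProd_succ, mul_comm]
      exact mul_le_mul_of_nonneg_left (hratio w w' k y) ((hc w').headProd_nonneg _ _)
    rw [hk, headProd_succ]
    have := mul_le_mul_of_nonneg_left hstep (mul_nonneg hlam.le ((hc w).nonneg k y))
    linarith

/-- Lower bound on the duration of the confirmation phase. -/
theorem confirmation_phase_le [Nontrivial W] {c : W → Fin N → (Fin N → Y) → ℝ}
    (hc : ∀ w, IsKernel (c w)) {lam : ℝ} (hlam : 0 < lam)
    (hratio : ∀ w w' k y, lam * c w k y ≤ c w' k y) {D : ℝ} (hD0 : 0 ≤ D)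
    (hD : ∀ w w' (k : Fin N) y, ∑ a, c w k (Function.update y k a) *
      Real.log (c w k (Function.update y k a) / c w' k (Function.update y k a)) ≤ D)
    {τ T : (Fin N → Y) → ℕ} (hτ : IsStop τ) (hT : IsStop T) (hle : ∀ y, τ y ≤ T y)
    (hN : ∀ y, T y ≤ N) {est dec : (Fin N → Y) → W} (hest : Stopped τ est) (hdec : Stopped T dec)
    {κ : ℝ} (hκ : 0 < κ) (hrest : ∀ w y, κ * headProd (c w) (τ y) y ≤ restSum c w (τ y) y)
    {Pe : ℝ} (hPe : 0 < Pe)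
    (herr : ∑ w, ∑ y, (∏ k, c w k y) * (if dec y = w then 0 else 1) = Fintype.card W * Pe) :
    Real.log Pe⁻¹ * (∑ w, ∑ y, (∏ k, c w k y) * (if est y = w ∧ dec y = w then 1 else 0)) -
        2 * Fintype.card W / κ ≤
      D * ∑ w, ∑ y, (∏ k, c w k y) * ((T y : ℝ) - τ y) := by
  set u : ℝ := (Fintype.card Y : ℝ)⁻¹ with hu
  have hu0 : 0 ≤ u := by positivity
  have hpos : ∀ w w' n y, 0 < headProd (c w) n y → 0 < headProd (c w') n y := by
    intro w w' n y h
    refine Finset.prod_pos fun k hk => ?_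
    have h1 : 0 < c w k y := lt_of_le_of_ne ((hc w).nonneg k y) fun h0 =>
      h.ne' (Finset.prod_eq_zero hk h0.symm)
    exact (mul_pos hlam h1).trans_le (hratio w w' k y)
  have hrpos : ∀ w n y, 0 < headProd (c w) n y → 0 < restSum c w n y := by
    intro w n y h
    obtain ⟨w', hw'⟩ := exists_ne w
    exact Finset.sum_pos' (fun v _ => (hc v).headProd_nonneg _ _)
      ⟨w', Finset.mem_erase.2 ⟨hw', Finset.mem_univ _⟩, hpos w w' n y h⟩
  -- Only paths whose estimate at `τ` is the true message are followed; this event is known before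
  -- each confirmation step.
  let ind : W → Fin N → (Fin N → Y) → ℝ := fun w k y =>
    if est y = w ∧ τ y ≤ k ∧ (k : ℕ) < T y then 1 else 0
  have hind0 : ∀ w k y, 0 ≤ ind w k y := fun w k y => by simp only [ind]; split_ifs <;> norm_num
  have hinddep : ∀ w (k : Fin N), DependsOnFirst k (ind w k) := by
    intro w k y y' h
    have h1 : (est y = w ∧ τ y ≤ k ∧ (k : ℕ) < T y) ↔ (est y' = w ∧ τ y' ≤ k ∧ (k : ℕ) < T y') := by
      rw [← not_le, ← not_le, hT.le_iff h, ← hτ.le_iff h]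
      by_cases h2 : τ y ≤ k
      · rw [hest y y' (h.mono h2)]
      · simp [h2]
    simp only [ind, h1]
  -- The increment at step `k` of the log-likelihood ratio between `w` and the rest. Its conditional
  -- mean is the divergence of row `w` from a likelihood-weighted mixture of the other rows.
  let φ : W → Fin N → (Fin N → Y) → ℝ := fun w k y =>
    Real.log (c w k y * restSum c w k y / restSum c w (k + 1) y)
  -- each transmission of the confirmation phase contributes at most `D`
  have hstep : ∀ w k, ∑ y, (∏ j, c w j y) * (ind w k y * φ w k y) ≤
      D * ∑ y, (∏ j, c w j y) * ind w k y := by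
    intro w k
    have h1 := (hc w).sum_mul_tailProd_mul_le k (H := fun y => headProd (c w) k y * ind w k y)
      (φ := φ w k) (D := D) ?_ ?_ ?_ ?_
    · have e : ∀ y, headProd (c w) k y * ind w k y * tailProd (c w) k y =
          (∏ j, c w j y) * ind w k y := fun y => by
        rw [← headProd_mul_tailProd (c w) k y]; ring
      simpa only [e, mul_assoc] using h1
    · intro y y' h
      simp only [(hc w).headProd_dep k y y' h, hinddep w k y y' h]
    · exact fun y => mul_nonneg ((hc w).headProd_nonneg _ _) (hind0 w k y)
    · intro y y' h
      simp only [φ, (hc w).adapted k y y' h, restSum_dep hc w (k + 1) y y' h,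
        restSum_dep hc w k y y' (h.mono (Nat.le_succ _))]
    · intro y hy
      have hL : 0 < headProd (c w) k y := by
        refine lt_of_le_of_ne ((hc w).headProd_nonneg _ _) fun h0 => ?_
        simp [← h0] at hy
      have e1 : ∀ a, restSum c w k (Function.update y k a) = restSum c w k y := fun a =>
        (restSum_dep hc w k _ _ (agree_update k y a)).symm
      have e2 : ∀ a, restSum c w (k + 1) (Function.update y k a) =
          ∑ w' ∈ Finset.univ.erase w, headProd (c w') k y * c w' k (Function.update y k a) := by
        intro a
        refine Finset.sum_congr rfl fun w' _ => ?_
        rw [headProd_succ, (hc w').headProd_dep k _ _ (agree_update k y a).symm]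
      simp only [φ, e1, e2]
      exact sum_mul_log_div_mixture_le (fun w' _ => (hc w').headProd_nonneg _ _)
        (hrpos w k y hL) (fun a => (hc w).nonneg _ _)
        (fun w' _ a ha => (mul_pos hlam ha).trans_le (hratio w w' k _))
        (fun w' _ => hD w w' k y)
  have hup : ∑ w, ∑ y, (∏ j, c w j y) * ∑ k, ind w k y * φ w k y ≤
      D * ∑ w, ∑ y, (∏ k, c w k y) * ((T y : ℝ) - τ y) := by
    rw [Finset.mul_sum]
    refine Finset.sum_le_sum fun w _ => ?_
    calc ∑ y, (∏ j, c w j y) * ∑ k, ind w k y * φ w k y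
        = ∑ k, ∑ y, (∏ j, c w j y) * (ind w k y * φ w k y) := by
          rw [Finset.sum_comm]
          simp only [Finset.mul_sum]
      _ ≤ ∑ k, D * ∑ y, (∏ j, c w j y) * ind w k y := Finset.sum_le_sum fun k _ => hstep w k
      _ = D * ∑ y, (∏ j, c w j y) * ∑ k, ind w k y := by
          rw [← Finset.mul_sum, Finset.sum_comm]
          simp only [Finset.mul_sum]
      _ ≤ _ := by
          refine mul_le_mul_of_nonneg_left (Finset.sum_le_sum fun y _ =>
            mul_le_mul_of_nonneg_left ?_ ((hc w).prod_nonneg y)) hD0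
          rw [← sum_ite_telescope (fun n => (n : ℝ)) (hle y) (hN y)]
          refine Finset.sum_le_sum fun k _ => ?_
          simp only [ind]
          split_ifs with h1 h2 h2
          · simp
          · exact absurd h1.2 h2
          · simp
          · simp
  -- The weight `1 / Pe` on correct decoding is as large as possible while the total in `hVsum`
  -- stays of order `|W|`.
  let g : W → (Fin N → Y) → ℝ := fun w y => if dec y = w then Pe⁻¹ else 1
  have hg : ∀ w y, 0 < g w y := fun w y => by simp only [g]; split_ifs <;> positivity
  let V : W → (Fin N → Y) → ℝ := fun w y =>
    (if est y = w then g w y else 0) * restSum c w (T y) y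
  -- `log x ≤ x - 1` at `x = g` times the likelihood ratio at `τ` over that at `T`; the ratio at `τ`
  -- is at most `1 / κ`.
  have hpt : ∀ w y, Real.log Pe⁻¹ *
      ((∏ k, c w k y) * (if est y = w ∧ dec y = w then 1 else 0)) ≤
      (∏ j, c w j y) * ∑ k, ind w k y * φ w k y +
        κ⁻¹ * (V w y * tailProd (c w) (T y) y) := by
    intro w y
    have hV : 0 ≤ κ⁻¹ * (V w y * tailProd (c w) (T y) y) := by
      refine mul_nonneg (by positivity) (mul_nonneg (mul_nonneg ?_ (restSum_nonneg hc _ _ _))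
        ((hc w).tailProd_nonneg _ _))
      split_ifs
      · exact (hg w y).le
      · exact le_rfl
    by_cases he : est y = w
    · rcases ((hc w).prod_nonneg y).eq_or_lt with h0 | h0
      · simp only [← h0, zero_mul, mul_zero, zero_add]
        exact hV
      · have hall : ∀ w' k, 0 < c w' k y := fun w' k => by
          have : 0 < c w k y := lt_of_le_of_ne ((hc w).nonneg k y) fun hk =>
            h0.ne' (Finset.prod_eq_zero (Finset.mem_univ k) hk.symm)
          exact (mul_pos hlam this).trans_le (hratio w w' k y)
        have hL : ∀ n, 0 < headProd (c w) n y := fun n => Finset.prod_pos fun k _ => hall w k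
        have hR : ∀ n, 0 < restSum c w n y := fun n => hrpos w n y (hL n)
        have hsum : ∑ k, ind w k y * φ w k y =
            (Real.log (headProd (c w) (T y) y) - Real.log (restSum c w (T y) y)) -
            (Real.log (headProd (c w) (τ y) y) - Real.log (restSum c w (τ y) y)) := by
          rw [← sum_ite_telescope (fun n => Real.log (headProd (c w) n y) -
            Real.log (restSum c w n y)) (hle y) (hN y)]
          refine Finset.sum_congr rfl fun k _ => ?_
          simp only [ind, he, true_and]
          split_ifs
          · simp only [φ, one_mul]
            rw [Real.log_div (mul_pos (hall w k) (hR k)).ne' (hR _).ne',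
              Real.log_mul (hall w k).ne' (hR k).ne', headProd_succ,
              Real.log_mul (hL k).ne' (hall w k).ne']
            ring
          · simp
        have hlog : Real.log Pe⁻¹ *
            ((∏ k, c w k y) * (if est y = w ∧ dec y = w then 1 else 0)) =
            (∏ k, c w k y) * Real.log (g w y) := by
          simp only [g, he, true_and]
          split_ifs
          · ring
          · simp
        have hx : 0 < g w y * headProd (c w) (τ y) y * restSum c w (T y) y /
            (headProd (c w) (T y) y * restSum c w (τ y) y) :=
          div_pos (mul_pos (mul_pos (hg w y) (hL _)) (hR _)) (mul_pos (hL _) (hR _))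
        have h1 := Real.log_le_sub_one_of_pos hx
        rw [Real.log_div (mul_pos (mul_pos (hg w y) (hL _)) (hR _)).ne'
          (mul_pos (hL _) (hR _)).ne', Real.log_mul (mul_pos (hg w y) (hL _)).ne' (hR _).ne',
          Real.log_mul (hg w y).ne' (hL _).ne', Real.log_mul (hL _).ne' (hR _).ne'] at h1
        have h2 := mul_le_mul_of_nonneg_left h1 h0.le
        have h3 : (∏ j, c w j y) * (g w y * headProd (c w) (τ y) y * restSum c w (T y) y /
            (headProd (c w) (T y) y * restSum c w (τ y) y)) ≤
            κ⁻¹ * (V w y * tailProd (c w) (T y) y) := by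
          have h4 : headProd (c w) (τ y) y / restSum c w (τ y) y ≤ κ⁻¹ := by
            rw [div_le_iff₀ (hR _), ← div_eq_inv_mul, le_div_iff₀ hκ, mul_comm]
            exact hrest w y
          have h5 : (∏ j, c w j y) * (g w y * headProd (c w) (τ y) y * restSum c w (T y) y /
            (headProd (c w) (T y) y * restSum c w (τ y) y)) =
            headProd (c w) (τ y) y / restSum c w (τ y) y *
              (V w y * tailProd (c w) (T y) y) := by
            rw [← headProd_mul_tailProd (c w) (T y) y]
            have := (hL (T y)).ne'
            have := (hR (τ y)).ne'
            simp only [V, he, if_true]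
            field_simp
          rw [h5]
          refine mul_le_mul_of_nonneg_right h4 ?_
          simp only [V, he, if_true]
          exact mul_nonneg (mul_pos (hg w y) (hR _)).le ((hc w).tailProd_nonneg _ _)
        rw [hlog, hsum]
        linarith
    · have : ∀ k, ind w k y = 0 := fun k => by simp [ind, he]
      simpa [this, he] using hV
  -- For each `y` only `w = est y` contributes. When `dec y = est y`, the likelihoods in its
  -- `restSum` are exactly the decoder's error mass, of total `|W| Pe`, weighted by `1 / Pe`;
  -- otherwise the weight is `1` and the total mass `|W|` suffices.
  have hVsum : ∑ w, ∑ y, V w y * tailProd (c w) (T y) y ≤ 2 * Fintype.card W := by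
    have hVst : ∀ w, Stopped T (V w) := by
      intro w y y' h
      have h1 : restSum c w (T y) y = restSum c w (T y') y' := by
        rw [← hT y y' h]
        exact restSum_dep hc w _ y y' h
      simp only [V, g, h1, hdec y y' h, hest.mono hle y y' h]
    have h1 : ∀ w, ∑ y, V w y * tailProd (c w) (T y) y = ∑ y, V w y * u ^ (N - T y) := fun w =>
      (hc w).sum_mul_tailProd_time hT hN (hVst w)
    have h2 : ∀ w, ∑ y, (∏ k, c w k y) * (1 + Pe⁻¹ * (if dec y = w then (0 : ℝ) else 1)) =
        ∑ y, u ^ (N - T y) * (headProd (c w) (T y) y *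
          (1 + Pe⁻¹ * (if dec y = w then (0 : ℝ) else 1))) := fun w =>
      (hc w).sum_prod_mul hT hN fun y y' h => by simp [hdec y y' h]
    have h3 : ∑ w, ∑ y, (∏ k, c w k y) * (1 + Pe⁻¹ * (if dec y = w then (0 : ℝ) else 1)) =
        2 * Fintype.card W := by
      have e : ∀ w y, (∏ k, c w k y) * (1 + Pe⁻¹ * (if dec y = w then (0 : ℝ) else 1)) =
          (∏ k, c w k y) + Pe⁻¹ * ((∏ k, c w k y) * (if dec y = w then (0 : ℝ) else 1)) :=
        fun w y => by ring
      simp only [e, Finset.sum_add_distrib, ← Finset.mul_sum, herr, (hc _).sum_prod]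
      simp only [Finset.sum_const, Finset.card_univ, nsmul_eq_mul, mul_one]
      field_simp
      norm_num
    rw [← h3]
    simp only [h1, h2]
    rw [Finset.sum_comm, Finset.sum_comm (s := Finset.univ (α := W))]
    refine Finset.sum_le_sum fun y _ => ?_
    rw [← Finset.mul_sum, ← Finset.sum_mul, mul_comm]
    refine mul_le_mul_of_nonneg_left ?_ (pow_nonneg hu0 _)
    simp only [V, ite_mul, zero_mul, Finset.sum_ite_eq, Finset.mem_univ, if_true]
    rw [restSum, Finset.mul_sum]
    calc ∑ w' ∈ Finset.univ.erase (est y), g (est y) y * headProd (c w') (T y) y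
        ≤ ∑ w' ∈ Finset.univ.erase (est y), headProd (c w') (T y) y *
          (1 + Pe⁻¹ * (if dec y = w' then (0 : ℝ) else 1)) := by
          refine Finset.sum_le_sum fun w' hw' => ?_
          rw [mul_comm]
          refine mul_le_mul_of_nonneg_left ?_ ((hc w').headProd_nonneg _ _)
          have hne := (Finset.mem_erase.1 hw').1
          simp only [g]
          have hPi : 0 < Pe⁻¹ := by positivity
          by_cases h5 : dec y = est y
          · have h6 : ¬ est y = w' := fun h => hne h.symm
            simp only [h5, if_true, h6, if_false]
            linarith
          · simp only [h5, if_false]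
            split_ifs <;> linarith
      _ ≤ _ := by
          refine Finset.sum_le_sum_of_subset_of_nonneg (Finset.erase_subset _ _) fun w' _ _ => ?_
          refine mul_nonneg ((hc w').headProd_nonneg _ _) ?_
          split_ifs <;> simp only [mul_zero, mul_one] <;> positivity
  have hfin := Finset.sum_le_sum fun w (_ : w ∈ Finset.univ) =>
    Finset.sum_le_sum fun y (_ : y ∈ Finset.univ) => hpt w y
  simp only [Finset.sum_add_distrib, ← Finset.mul_sum] at hfin
  have h7 : κ⁻¹ * ∑ w, ∑ y, V w y * tailProd (c w) (T y) y ≤ 2 * Fintype.card W / κ := by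
    rw [div_eq_inv_mul]
    exact mul_le_mul_of_nonneg_left hVsum (by positivity)
  simp only [Finset.mul_sum] at hfin hup h7 ⊢
  linarith

end Confirmation

/-! ### Finite probability and entropy -/

section Entropy

variable {Ω α γ : Type*} [Fintype Ω] [Fintype α] [Fintype γ] (μ : PMF Ω)

lemma prob_nonneg (A : Set Ω) : 0 ≤ prob μ A :=
  Finset.sum_nonneg fun _ _ => indicator_nonneg (fun _ _ => ENNReal.toReal_nonneg) _

lemma prob_mono {A B : Set Ω} (h : A ⊆ B) : prob μ A ≤ prob μ B :=
  Finset.sum_le_sum fun ω _ =>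
    indicator_le_indicator_of_subset h (fun _ => ENNReal.toReal_nonneg) ω

lemma prob_eq_zero_of_subset {A B : Set Ω} (h : A ⊆ B) (hB : prob μ B = 0) : prob μ A = 0 :=
  le_antisymm (hB ▸ prob_mono μ h) (prob_nonneg μ A)

lemma prob_mul_condProb (B A : Set Ω) : prob μ A * condProb μ B A = prob μ (B ∩ A) := by
  by_cases h : prob μ A = 0
  · rw [h, zero_mul, prob_eq_zero_of_subset μ inter_subset_right h]
  · rw [condProb, mul_div_cancel₀ _ h]

lemma prob_pos_of_mem {A : Set Ω} {ω : Ω} (hω : ω ∈ A) (h : 0 < (μ ω).toReal) :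
    0 < prob μ A := by
  refine h.trans_le ?_
  have := Finset.single_le_sum (f := fun ω => A.indicator (fun ω => (μ ω).toReal) ω)
    (fun ω _ => indicator_nonneg (fun _ _ => ENNReal.toReal_nonneg) ω) (Finset.mem_univ ω)
  simpa [prob, indicator_of_mem hω] using this

lemma condProb_pos_of_mem {A B : Set Ω} {ω : Ω} (hA : ω ∈ A) (hB : ω ∈ B)
    (h : 0 < (μ ω).toReal) : 0 < condProb μ B A :=
  div_pos (prob_pos_of_mem μ ⟨hB, hA⟩ h) (prob_pos_of_mem μ hA h)

open Classical in
lemma sum_indicator_mul_eq (A : Set Ω) (V : Ω → α) (Z : Ω → γ) (F : α → γ → ℝ) :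
    ∑ ω, A.indicator (fun ω => (μ ω).toReal * F (V ω) (Z ω)) ω =
      ∑ z, ∑ v, prob μ (V ⁻¹' {v} ∩ (Z ⁻¹' {z} ∩ A)) * F v z := by
  simp only [prob, Finset.sum_mul]
  have h1 : ∀ z : γ, ∑ v, ∑ ω, (V ⁻¹' {v} ∩ (Z ⁻¹' {z} ∩ A)).indicator
      (fun ω => (μ ω).toReal) ω * F v z = ∑ ω, ∑ v, (V ⁻¹' {v} ∩ (Z ⁻¹' {z} ∩ A)).indicator
      (fun ω => (μ ω).toReal) ω * F v z := fun z => Finset.sum_comm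
  simp only [h1]
  rw [Finset.sum_comm]
  refine Finset.sum_congr rfl fun ω _ => ?_
  rw [Finset.sum_eq_single (Z ω), Finset.sum_eq_single (V ω)]
  · by_cases h : ω ∈ A <;> simp [indicator, h]
  · intro v _ hv
    simp [indicator, Ne.symm hv]
  · simp
  · intro z _ hz
    refine Finset.sum_eq_zero fun v _ => ?_
    simp [indicator, Ne.symm hz]
  · simp

lemma sum_prob_inter (A : Set Ω) (V : Ω → α) : ∑ v, prob μ (V ⁻¹' {v} ∩ A) = prob μ A := by
  have h := sum_indicator_mul_eq μ A V (fun _ => ()) (fun _ _ => 1)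
  simpa [prob] using h.symm

/-- Multiplying by `prob μ A` gives an unnormalized sum over `Ω`, so null conditioning events need
no separate treatment. -/
lemma prob_mul_condEntropy (A : Set Ω) (V : Ω → α) (Z : Ω → γ) :
    prob μ A * condEntropy μ A V Z * Real.log 2 =
      -∑ ω, A.indicator (fun ω => (μ ω).toReal *
        Real.log (condProb μ (V ⁻¹' {V ω}) (Z ⁻¹' {Z ω} ∩ A))) ω := by
  rw [sum_indicator_mul_eq μ A V Z
    (fun v z => Real.log (condProb μ (V ⁻¹' {v}) (Z ⁻¹' {z} ∩ A)))]
  have h2 : Real.log 2 ≠ 0 := (Real.log_pos one_lt_two).ne'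
  rw [condEntropy, Finset.mul_sum, Finset.sum_mul, ← Finset.sum_neg_distrib]
  refine Finset.sum_congr rfl fun z _ => ?_
  rw [← mul_assoc, prob_mul_condProb, entropy, ← Finset.sum_div, mul_assoc, div_mul_cancel₀ _ h2,
    Finset.mul_sum, ← Finset.sum_neg_distrib]
  refine Finset.sum_congr rfl fun v _ => ?_
  rw [← prob_mul_condProb μ (V ⁻¹' {v}), Real.negMulLog]
  ring

/-- Gibbs' inequality. -/
lemma sum_log_le_sum_log_condProb (A : Set Ω) (V : Ω → α) (Z : Ω → γ) (r : γ → α → ℝ)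
    (hr0 : ∀ z v, 0 ≤ r z v) (hr1 : ∀ z, ∑ v, r z v ≤ 1)
    (hr : ∀ ω, 0 < (μ ω).toReal → 0 < r (Z ω) (V ω)) :
    ∑ ω, A.indicator (fun ω => (μ ω).toReal * Real.log (r (Z ω) (V ω))) ω ≤
      ∑ ω, A.indicator (fun ω => (μ ω).toReal *
        Real.log (condProb μ (V ⁻¹' {V ω}) (Z ⁻¹' {Z ω} ∩ A))) ω := by
  rw [sum_indicator_mul_eq μ A V Z (fun v z => Real.log (r z v)),
    sum_indicator_mul_eq μ A V Z (fun v z => Real.log (condProb μ (V ⁻¹' {v}) (Z ⁻¹' {z} ∩ A)))]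
  refine Finset.sum_le_sum fun z _ => ?_
  set C := Z ⁻¹' {z} ∩ A with hC
  have hpt : ∀ v, prob μ (V ⁻¹' {v} ∩ C) * Real.log (r z v) ≤
      prob μ (V ⁻¹' {v} ∩ C) * Real.log (condProb μ (V ⁻¹' {v}) C) +
        (prob μ C * r z v - prob μ (V ⁻¹' {v} ∩ C)) := by
    intro v
    rcases (prob_nonneg μ (V ⁻¹' {v} ∩ C)).eq_or_lt with h | h
    · rw [← h]
      simpa using mul_nonneg (prob_nonneg μ C) (hr0 z v)
    · have hCpos : 0 < prob μ C := h.trans_le (prob_mono μ inter_subset_right)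
      have hc : 0 < condProb μ (V ⁻¹' {v}) C := div_pos h hCpos
      have hrp : 0 < r z v := by
        obtain ⟨ω, hω⟩ : ∃ ω, (V ⁻¹' {v} ∩ C).indicator (fun ω => (μ ω).toReal) ω ≠ 0 := by
          by_contra! hcon
          exact h.ne' (Finset.sum_eq_zero fun ω _ => hcon ω)
        have hmem : ω ∈ V ⁻¹' {v} ∩ C := mem_of_indicator_ne_zero hω
        rw [indicator_of_mem hmem] at hω
        have h1 := hr ω (lt_of_le_of_ne ENNReal.toReal_nonneg hω.symm)
        rwa [show V ω = v from hmem.1, show Z ω = z from hmem.2.1] at h1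
      have h1 := Real.log_le_sub_one_of_pos (div_pos hrp hc)
      rw [Real.log_div hrp.ne' hc.ne'] at h1
      have h2 := mul_le_mul_of_nonneg_left h1 h.le
      have h3 : prob μ (V ⁻¹' {v} ∩ C) * (r z v / condProb μ (V ⁻¹' {v}) C) =
          prob μ C * r z v := by
        rw [condProb]
        field_simp
      linarith
  have h4 := Finset.sum_le_sum fun v (_ : v ∈ Finset.univ) => hpt v
  rw [Finset.sum_add_distrib, Finset.sum_sub_distrib, ← Finset.mul_sum, sum_prob_inter] at h4
  nlinarith [mul_le_mul_of_nonneg_left (hr1 z) (prob_nonneg μ C)]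

/-- By Gibbs, cross-entropy against any substochastic `r` dominates `H(V | U, Z, A)`. The channel
can thus be inserted as `r` without showing that it is the true conditional law. -/
lemma sum_indicator_div_le_condMutualInfo {β : Type*} [Fintype β] (A : Set Ω) (U : Ω → β)
    (V : Ω → α) (Z : Ω → γ) (r : β × γ → α → ℝ)
    (hr0 : ∀ z v, 0 ≤ r z v) (hr1 : ∀ z, ∑ v, r z v ≤ 1)
    (hr : ∀ ω, 0 < (μ ω).toReal → 0 < r (U ω, Z ω) (V ω)) :
    ∑ ω, A.indicator (fun ω => (μ ω).toReal * Real.log (r (U ω, Z ω) (V ω) /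
        condProb μ (V ⁻¹' {V ω}) (Z ⁻¹' {Z ω} ∩ A))) ω ≤
      prob μ A * condMutualInfo μ A U V Z * Real.log 2 := by
  have h1 := sum_log_le_sum_log_condProb μ A V (fun ω => (U ω, Z ω)) r hr0 hr1 hr
  have h2 := prob_mul_condEntropy μ A V Z
  have h3 := prob_mul_condEntropy μ A V (fun ω => (U ω, Z ω))
  have h4 : ∑ ω, A.indicator (fun ω => (μ ω).toReal * Real.log (r (U ω, Z ω) (V ω) /
        condProb μ (V ⁻¹' {V ω}) (Z ⁻¹' {Z ω} ∩ A))) ω =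
      ∑ ω, A.indicator (fun ω => (μ ω).toReal * Real.log (r (U ω, Z ω) (V ω))) ω -
      ∑ ω, A.indicator (fun ω => (μ ω).toReal *
        Real.log (condProb μ (V ⁻¹' {V ω}) (Z ⁻¹' {Z ω} ∩ A))) ω := by
    rw [← Finset.sum_sub_distrib]
    refine Finset.sum_congr rfl fun ω _ => ?_
    by_cases hω : ω ∈ A
    · simp only [indicator_of_mem hω]
      rcases (ENNReal.toReal_nonneg (a := μ ω)).eq_or_lt with h | h
      · simp [← h]
      · have hc : 0 < condProb μ (V ⁻¹' {V ω}) (Z ⁻¹' {Z ω} ∩ A) :=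
          condProb_pos_of_mem μ (ω := ω) ⟨rfl, hω⟩ rfl h
        rw [Real.log_div (hr ω h).ne' hc.ne', mul_sub]
    · simp [indicator_of_notMem hω]
  rw [h4, condMutualInfo, mul_sub, sub_mul, h2, h3]
  linarith

end Entropy

/-! ### Directed information -/

section Directed

variable {Y : Type*} {N : ℕ}

lemma past_eq_iff {k : Fin N} {y y' : Fin N → Y} : past k y = past k y' ↔ Agree k y y' := by
  constructor
  · intro h i hi
    exact congrFun h ⟨i, hi⟩
  · intro h
    funext i
    exact h _ i.2

lemma upto_eq_iff {k : Fin N} {y y' : Fin N → Y} :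
    upto k y = upto k y' ↔ Agree (k + 1) y y' := by
  constructor
  · intro h i hi
    exact congrFun h ⟨i, hi⟩
  · intro h
    funext i
    exact h _ i.2

-- Used with `κ` the past outputs, so that the conditional informations can be treated one history
-- at a time.
open Classical in
lemma sum_le_sum_of_fiberwise {Ω ζ : Type*} [Fintype Ω] [Fintype ζ] (κ : Ω → ζ) (f g : Ω → ℝ)
    (h : ∀ ω₀, ∑ ω, {ω | κ ω = κ ω₀}.indicator f ω ≤ ∑ ω, {ω | κ ω = κ ω₀}.indicator g ω) :
    ∑ ω, f ω ≤ ∑ ω, g ω := by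
  rw [← Finset.sum_fiberwise (s := Finset.univ) (g := κ) (f := f),
    ← Finset.sum_fiberwise (s := Finset.univ) (g := κ) (f := g)]
  refine Finset.sum_le_sum fun z _ => ?_
  rw [Finset.sum_filter, Finset.sum_filter]
  by_cases hz : ∃ ω₀, κ ω₀ = z
  · obtain ⟨ω₀, rfl⟩ := hz
    simpa [indicator] using h ω₀
  · push Not at hz
    simp [hz]

variable [Fintype Y] {X₁ X₂ : Type*} [Fintype X₁] [Fintype X₂]

lemma sum_log_div_le_expectSum (P : PMF (Paths X₁ X₂ Y N)) (τ : StopTime Y N)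
    (hτ : IsStop τ.time) {β γ : Fin N → Type*} [∀ k, Fintype (β k)] [∀ k, Fintype (γ k)]
    (U : ∀ k, Paths X₁ X₂ Y N → β k) (Z : ∀ k, Paths X₁ X₂ Y N → γ k)
    (r : ∀ k, β k × γ k → Y → ℝ)
    (hr0 : ∀ k z v, 0 ≤ r k z v) (hr1 : ∀ k z, ∑ v, r k z v ≤ 1)
    (hr : ∀ k ω, 0 < (P ω).toReal → 0 < r k (U k ω, Z k ω) (ω.2.2 k)) :
    ∑ ω, (P ω).toReal * ∑ k : Fin N, (if (k : ℕ) < τ.time ω.2.2 then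
        Real.log (r k (U k ω, Z k ω) (ω.2.2 k) /
          condProb P ((fun ω => ω.2.2 k) ⁻¹' {ω.2.2 k})
            (Z k ⁻¹' {Z k ω} ∩ pastEvent k ω.2.2)) else 0) ≤
      expectSum P τ (fun k y => condMutualInfo P (pastEvent k y) (U k) (fun ω => ω.2.2 k) (Z k)) *
        Real.log 2 := by
  simp only [expectSum, expect, Finset.mul_sum, Finset.sum_mul]
  rw [Finset.sum_comm, Finset.sum_comm (s := Finset.univ (α := Paths X₁ X₂ Y N))]
  refine Finset.sum_le_sum fun k _ => ?_
  refine sum_le_sum_of_fiberwise (fun ω : Paths X₁ X₂ Y N => past k ω.2.2) _ _ fun ω₀ => ?_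
  change ∑ ω, (pastEvent k ω₀.2.2).indicator _ ω ≤ ∑ ω, (pastEvent k ω₀.2.2).indicator _ ω
  have hev : ∀ ω ∈ pastEvent (X₁ := X₁) (X₂ := X₂) k ω₀.2.2,
      pastEvent (X₁ := X₁) (X₂ := X₂) k ω.2.2 = pastEvent k ω₀.2.2 := by
    intro ω hω
    simp only [pastEvent, mem_ofPred_eq] at hω ⊢
    rw [hω]
  have hlt : ∀ ω ∈ pastEvent (X₁ := X₁) (X₂ := X₂) k ω₀.2.2,
      ((k : ℕ) < τ.time ω.2.2 ↔ (k : ℕ) < τ.time ω₀.2.2) := by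
    intro ω hω
    -- The event `{τ > k}` is decided by the first `k` outputs, hence constant on each history.
    rw [← not_le, ← not_le, hτ.le_iff (past_eq_iff.1 hω)]
  by_cases hk : (k : ℕ) < τ.time ω₀.2.2
  · convert sum_indicator_div_le_condMutualInfo P (pastEvent k ω₀.2.2) (U k) (fun ω => ω.2.2 k)
      (Z k) (r k) (hr0 k) (hr1 k) (hr k) using 1
    · refine Finset.sum_congr rfl fun ω _ => ?_
      by_cases hω : ω ∈ pastEvent (X₁ := X₁) (X₂ := X₂) k ω₀.2.2
      · simp only [indicator_of_mem hω, hlt ω hω, hk, if_true, hev ω hω]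
      · simp only [indicator_of_notMem hω]
    · rw [prob, Finset.sum_mul, Finset.sum_mul]
      refine Finset.sum_congr rfl fun ω _ => ?_
      by_cases hω : ω ∈ pastEvent (X₁ := X₁) (X₂ := X₂) k ω₀.2.2
      · simp only [indicator_of_mem hω, hlt ω hω, hk, if_true, hev ω hω]
      · simp only [indicator_of_notMem hω, zero_mul]
  · refine Finset.sum_le_sum fun ω _ => ?_
    by_cases hω : ω ∈ pastEvent (X₁ := X₁) (X₂ := X₂) k ω₀.2.2
    · simp [indicator_of_mem hω, hlt ω hω, hk]
    · simp [indicator_of_notMem hω]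

variable [DecidableEq Y] [Nonempty Y] {A B : Type*} [Fintype A] [Fintype B]

open Classical in
/-- The conditional law of the outputs given side information `z k y` about the inputs. -/
noncomputable def sideKernel (P : PMF (Paths X₁ X₂ Y N)) {γ : Fin N → Type*}
    (Z : ∀ k, Paths X₁ X₂ Y N → γ k) (z : ∀ k, (Fin N → Y) → γ k) (k : Fin N)
    (y : Fin N → Y) : ℝ :=
  -- The uniform value on null histories keeps total mass one, where `condProb` would give `0`.
  if prob P (Z k ⁻¹' {z k y} ∩ pastEvent k y) = 0 then (Fintype.card Y : ℝ)⁻¹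
  else condProb P ((fun ω => ω.2.2 k) ⁻¹' {y k}) (Z k ⁻¹' {z k y} ∩ pastEvent k y)

lemma isKernel_sideKernel (P : PMF (Paths X₁ X₂ Y N)) {γ : Fin N → Type*}
    (Z : ∀ k, Paths X₁ X₂ Y N → γ k) (z : ∀ k, (Fin N → Y) → γ k)
    (hz : ∀ k : Fin N, DependsOnFirst k (z k)) : IsKernel (sideKernel P Z z) where
  nonneg k y := by
    rw [sideKernel]
    split_ifs
    · positivity
    · exact div_nonneg (prob_nonneg _ _) (prob_nonneg _ _)
  adapted k y y' h := by
    have h1 : z k y = z k y' := hz k y y' (h.mono (Nat.le_succ _))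
    have h2 : pastEvent (X₁ := X₁) (X₂ := X₂) k y = pastEvent k y' := by
      simp only [pastEvent, past_eq_iff.2 (h.mono (Nat.le_succ _))]
    rw [sideKernel, sideKernel, h1, h2, h k (Nat.lt_succ_self _)]
  sum_eq k y := by
    have h1 : ∀ a, z k (Function.update y k a) = z k y := fun a =>
      (hz k _ _ (agree_update k y a)).symm
    have h2 : ∀ a, pastEvent (X₁ := X₁) (X₂ := X₂) k (Function.update y k a) = pastEvent k y := by
      intro a
      simp only [pastEvent, past_eq_iff.2 (agree_update k y a)]
    simp only [sideKernel, h1, h2, Function.update_self]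
    split_ifs with h
    · simp
    · simp only [condProb]
      rw [← Finset.sum_div, sum_prob_inter P _ (fun ω : Paths X₁ X₂ Y N => ω.2.2 k), div_self h]

open Classical in
/-- Fano's inequality for the directed information of a feedback code. -/
lemma fano_directed [Nonempty A] {p : A → B → Fin N → (Fin N → Y) → ℝ}
    (hp : ∀ a b, IsKernel (p a b)) (P : PMF (Paths X₁ X₂ Y N))
    (pth : A → B → (Fin N → Y) → Paths X₁ X₂ Y N) (hpth : ∀ a b y, (pth a b y).2.2 = y)
    (hP : ∀ F : Paths X₁ X₂ Y N → ℝ, ∑ ω, (P ω).toReal * F ω =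
      (Fintype.card A * Fintype.card B : ℝ)⁻¹ *
        ∑ a, ∑ b, ∑ y, (∏ k, p a b k y) * F (pth a b y))
    (τ : StopTime Y N) (hτ : IsStop τ.time)
    {β γ : Fin N → Type*} [∀ k, Fintype (β k)] [∀ k, Fintype (γ k)]
    (U : ∀ k, Paths X₁ X₂ Y N → β k) (Z : ∀ k, Paths X₁ X₂ Y N → γ k)
    (r : ∀ k, β k × γ k → Y → ℝ)
    (hr0 : ∀ k z v, 0 ≤ r k z v) (hr1 : ∀ k z, ∑ v, r k z v ≤ 1)
    (hrp : ∀ k a b y, r k (U k (pth a b y), Z k (pth a b y)) (y k) = p a b k y)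
    (z : B → ∀ k, (Fin N → Y) → γ k) (hz : ∀ b (k : Fin N), DependsOnFirst k (z b k))
    (hZ : ∀ a b k y, Z k (pth a b y) = z b k y)
    {est : (Fin N → Y) → A} (hest : Stopped τ.time est) {θ : ℝ} (hθ : θ ∈ Ioo (0 : ℝ) 1) :
    (Fintype.card A * Fintype.card B : ℝ)⁻¹ * ∑ a, ∑ b, ∑ y, (∏ k, p a b k y) *
        (if est y = a then Real.log ((1 - θ) * Fintype.card A) else Real.log θ) ≤
      expectSum P τ (fun k y => condMutualInfo P (pastEvent k y) (U k) (fun ω => ω.2.2 k) (Z k)) *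
        Real.log 2 := by
  have hcard : (0 : ℝ) ≤ (Fintype.card A * Fintype.card B : ℝ)⁻¹ := by positivity
  have hppos : ∀ a b y, 0 < ∏ k, p a b k y → ∀ k, 0 < p a b k y := fun a b y h k =>
    lt_of_le_of_ne ((hp a b).nonneg k y) fun hk =>
      h.ne' (Finset.prod_eq_zero (Finset.mem_univ k) hk.symm)
  have hPpos : ∀ a b y, 0 < ∏ k, p a b k y → 0 < (P (pth a b y)).toReal := by
    intro a b y h
    have h1 := hP (fun ω => if ω = pth a b y then 1 else 0)
    simp only [mul_ite, mul_one, mul_zero, Finset.sum_ite_eq', Finset.mem_univ, if_true] at h1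
    rw [h1]
    have hA : 0 < Fintype.card A := Fintype.card_pos
    have hB : 0 < Fintype.card B := Fintype.card_pos_iff.2 ⟨b⟩
    refine mul_pos (by positivity) ?_
    have hnn : ∀ a' b' y', 0 ≤ (if pth a' b' y' = pth a b y then ∏ k, p a' b' k y' else 0) := by
      intro a' b' y'
      split_ifs
      · exact (hp a' b').prod_nonneg y'
      · exact le_rfl
    refine Finset.sum_pos' (fun a' _ => Finset.sum_nonneg fun b' _ =>
      Finset.sum_nonneg fun y' _ => hnn a' b' y') ⟨a, Finset.mem_univ _, ?_⟩
    refine Finset.sum_pos' (fun b' _ => Finset.sum_nonneg fun y' _ => hnn a b' y')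
      ⟨b, Finset.mem_univ _, ?_⟩
    refine Finset.sum_pos' (fun y' _ => hnn a b y') ⟨y, Finset.mem_univ _, ?_⟩
    simpa using h
  have hPex : ∀ ω, 0 < (P ω).toReal → ∃ a b, pth a b ω.2.2 = ω ∧ 0 < ∏ k, p a b k ω.2.2 := by
    intro ω hω
    by_contra! hcon
    have h1 := hP (fun ω' => if ω' = ω then 1 else 0)
    simp only [mul_ite, mul_one, mul_zero, Finset.sum_ite_eq', Finset.mem_univ, if_true] at h1
    rw [h1] at hω
    refine hω.ne' ?_
    rw [Finset.sum_eq_zero, mul_zero]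
    refine fun a _ => Finset.sum_eq_zero fun b _ => Finset.sum_eq_zero fun y _ => ?_
    split_ifs with h2
    · have h3 : ω.2.2 = y := by rw [← h2, hpth]
      subst h3
      exact le_antisymm (hcon a b h2) ((hp a b).prod_nonneg _)
    · rfl
  -- Along paths of positive probability the history is not null and the default value never
  -- appears.
  have hside : ∀ a b y, 0 < ∏ k, p a b k y → ∀ k, sideKernel P Z (z b) k y =
      condProb P ((fun ω => ω.2.2 k) ⁻¹' {y k}) (Z k ⁻¹' {z b k y} ∩ pastEvent k y) ∧
      0 < sideKernel P Z (z b) k y := by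
    intro a b y h k
    have hmem : pth a b y ∈ Z k ⁻¹' {z b k y} ∩ pastEvent k y :=
      ⟨hZ a b k y, by simp [pastEvent, hpth]⟩
    have h1 : sideKernel P Z (z b) k y =
        condProb P ((fun ω => ω.2.2 k) ⁻¹' {y k}) (Z k ⁻¹' {z b k y} ∩ pastEvent k y) :=
      if_neg (prob_pos_of_mem P hmem (hPpos a b y h)).ne'
    refine ⟨h1, ?_⟩
    rw [h1]
    exact condProb_pos_of_mem P hmem (by simp [hpth]) (hPpos a b y h)
  have h1 := sum_log_div_le_expectSum P τ hτ U Z r hr0 hr1 (fun k ω hω => by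
    obtain ⟨a, b, h2, h3⟩ := hPex ω hω
    rw [← h2, hpth, hrp]
    exact hppos a b _ h3 k)
  refine le_trans ?_ h1
  rw [hP]
  refine mul_le_mul_of_nonneg_left ?_ hcard
  refine (fano_stopped hp (fun b => isKernel_sideKernel P Z (z b) (hz b))
    (fun a b y h k => (hside a b y h k).2) hτ τ.le hest hθ).trans (le_of_eq ?_)
  refine Finset.sum_congr rfl fun a _ => Finset.sum_congr rfl fun b _ =>
    Finset.sum_congr rfl fun y _ => ?_
  rcases ((hp a b).prod_nonneg y).eq_or_lt with h0 | h0
  · rw [← h0, zero_mul, zero_mul]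
  · congr 1
    refine Finset.sum_congr rfl fun k _ => ?_
    rw [hpth, hrp, hZ, (hside a b y h0 k).1]

end Directed

/-! ### Divergence between rows of the channel -/

section Divergence

variable {Y : Type*} [Fintype Y]

/-- On a finite space the Radon–Nikodym derivative at an atom of positive `q`-mass is the quotient
of the masses. -/
lemma klBits_ne_top {p q : PMF Y} (h : klBits p q ≠ ⊤) :
    (∀ a, q a = 0 → p a = 0) ∧
      ∑ a, (p a).toReal * Real.log ((p a).toReal / (q a).toReal) =
        (klBits p q).toReal * Real.log 2 := by
  let _ : MeasurableSpace Y := ⊤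
  have : MeasurableSingletonClass Y := ⟨fun _ => trivial⟩
  have hlog : 0 < Real.log 2 := Real.log_pos one_lt_two
  have hkl : klBits p q =
      InformationTheory.klDiv p.toMeasure q.toMeasure / ENNReal.ofReal (Real.log 2) := rfl
  have h1 : InformationTheory.klDiv p.toMeasure q.toMeasure ≠ ⊤ := by
    intro h2
    rw [hkl, h2, ENNReal.top_div_of_ne_top ENNReal.ofReal_ne_top] at h
    exact h rfl
  have hac := (InformationTheory.klDiv_ne_top_iff.1 h1).1
  have hsupp : ∀ a, q a = 0 → p a = 0 := by
    intro a ha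
    have := @hac {a} (by rw [PMF.toMeasure_apply_singleton _ _ (measurableSet_singleton a), ha])
    rwa [PMF.toMeasure_apply_singleton _ _ (measurableSet_singleton a)] at this
  refine ⟨hsupp, ?_⟩
  rw [hkl, ENNReal.toReal_div, ENNReal.toReal_ofReal hlog.le, div_mul_cancel₀ _ hlog.ne',
    InformationTheory.toReal_klDiv_of_measure_eq hac (by simp), PMF.integral_eq_sum]
  refine Finset.sum_congr rfl fun a _ => ?_
  by_cases hq : q a = 0
  · simp [hsupp a hq]
  · have h3 : p a = p.toMeasure.rnDeriv q.toMeasure a * q a := by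
      conv_lhs => rw [← PMF.toMeasure_apply_singleton p a (measurableSet_singleton a),
        ← Measure.withDensity_rnDeriv_eq _ _ hac, withDensity_apply _ (measurableSet_singleton a),
        lintegral_singleton, PMF.toMeasure_apply_singleton _ _ (measurableSet_singleton a)]
    have h4 : (p a).toReal / (q a).toReal =
        (p.toMeasure.rnDeriv q.toMeasure a).toReal := by
      have h5 : (q a).toReal ≠ 0 := ENNReal.toReal_ne_zero.2 ⟨hq, q.apply_ne_top a⟩
      conv_lhs => rw [h3, ENNReal.toReal_mul, mul_div_assoc, div_self h5, mul_one]
    rw [h4, smul_eq_mul]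
    rfl

variable {X₁ X₂ : Type*} {Q : X₁ → X₂ → PMF Y}

lemma klBits_le_Dub (x₁ x₁' : X₁) (x₂ x₂' : X₂) : klBits (Q x₁ x₂) (Q x₁' x₂') ≤ Dub Q :=
  le_iSup_of_le x₁ <| le_iSup_of_le x₁' <| le_iSup_of_le x₂ <| le_iSup_of_le x₂' le_rfl

lemma sum_log_div_le_Dub (hD : Dub Q ≠ ⊤) (x₁ x₁' : X₁) (x₂ x₂' : X₂) :
    ∑ a, (Q x₁ x₂ a).toReal * Real.log ((Q x₁ x₂ a).toReal / (Q x₁' x₂' a).toReal) ≤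
      (Dub Q).toReal * Real.log 2 := by
  have hle := klBits_le_Dub (Q := Q) x₁ x₁' x₂ x₂'
  rw [(klBits_ne_top (ne_top_of_le_ne_top hD hle)).2]
  exact mul_le_mul_of_nonneg_right (ENNReal.toReal_mono hD hle) (Real.log_pos one_lt_two).le

/-- Finite divergences in all directions force a common support of all rows, so `lam` can be the
smallest positive transition probability. -/
lemma exists_ratio_bound [Fintype X₁] [Fintype X₂] (hD : Dub Q ≠ ⊤) :
    ∃ lam : ℝ, 0 < lam ∧ ∀ x₁ x₁' x₂ x₂' a,
      lam * (Q x₁ x₂ a).toReal ≤ (Q x₁' x₂' a).toReal := by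
  classical
  have hsupp : ∀ x₁ x₁' x₂ x₂' a, Q x₁' x₂' a = 0 → Q x₁ x₂ a = 0 := fun x₁ x₁' x₂ x₂' a =>
    (klBits_ne_top (ne_top_of_le_ne_top hD (klBits_le_Dub x₁ x₁' x₂ x₂'))).1 a
  let s : Finset (X₁ × X₂ × Y) := Finset.univ.filter fun z => 0 < (Q z.1 z.2.1 z.2.2).toReal
  obtain ⟨lam, hlam, hle⟩ : ∃ lam : ℝ, 0 < lam ∧ ∀ z ∈ s, lam ≤ (Q z.1 z.2.1 z.2.2).toReal := by
    rcases s.eq_empty_or_nonempty with h | h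
    · exact ⟨1, one_pos, by simp [h]⟩
    · obtain ⟨z, hz, hmin⟩ := s.exists_min_image (fun z => (Q z.1 z.2.1 z.2.2).toReal) h
      exact ⟨_, (Finset.mem_filter.1 hz).2, hmin⟩
  refine ⟨lam, hlam, fun x₁ x₁' x₂ x₂' a => ?_⟩
  by_cases h : Q x₁' x₂' a = 0
  · simp [h, hsupp x₁ x₁' x₂ x₂' a h]
  · have h1 : 0 < (Q x₁' x₂' a).toReal := ENNReal.toReal_pos h ((Q x₁' x₂').apply_ne_top a)
    have h2 : (Q x₁ x₂ a).toReal ≤ 1 := by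
      simpa using ENNReal.toReal_mono ENNReal.one_ne_top ((Q x₁ x₂).coe_le_one a)
    have h3 := hle (x₁', x₂', a) (Finset.mem_filter.2 ⟨Finset.mem_univ _, h1⟩)
    exact (mul_le_of_le_one_right hlam.le h2).trans h3

end Divergence

/-! ### Stopping times -/

section Stop

variable {Y : Type*} {N : ℕ}

/-- Each `{τ ≤ n}` is the preimage of a set under the first `n` coordinates. -/
lemma StopTime.isStop (τ : StopTime Y N) : IsStop τ.time := by
  have key : ∀ n : ℕ, ∀ y y', Agree n y y' → τ.time y ≤ n → τ.time y' ≤ n := by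
    intro n y y' h hn
    obtain ⟨B, -, hB⟩ := τ.isStoppingTime n
    have hmem : ∀ z : Fin N → Y, τ.time z ≤ n ↔ (fun i : {i : Fin N // (i : ℕ) < n} => z i) ∈ B := by
      intro z
      have := Set.ext_iff.1 hB z
      simp only [mem_preimage, mem_ofPred_eq] at this
      rw [this]
      exact Nat.cast_le.symm
    rw [hmem] at hn ⊢
    convert hn using 1
    funext i
    exact (h i i.2).symm
  intro y y' h
  have h1 := key _ y y' h le_rfl
  exact le_antisymm (key _ y' y (h.mono h1).symm le_rfl) h1

/-- The stopping time given by a function determined by the outputs up to its value. -/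
def IsStop.toStopTime {τ : (Fin N → Y) → ℕ} (hτ : IsStop τ) (h1 : ∀ y, 1 ≤ τ y)
    (hN : ∀ y, τ y ≤ N) : StopTime Y N where
  time := τ
  one_le := h1
  le := hN
  isStoppingTime := by
    intro n
    refine ⟨{z | ∃ y, τ y ≤ n ∧ (fun i : {i : Fin N // (i : ℕ) < n} => y i) = z}, trivial, ?_⟩
    ext y
    simp only [mem_preimage, mem_ofPred_eq]
    constructor
    · rintro ⟨y', h, he⟩
      have hag : Agree n y' y := fun i hi => congrFun he ⟨i, hi⟩
      exact Nat.cast_le.2 ((hτ.le_iff hag).1 h)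
    · intro h
      exact ⟨y, Nat.cast_le.1 h, rfl⟩

lemma VLC.stopped_decoded {X₁ X₂ : Type*} {M₁ M₂ : ℕ} (C : VLC X₁ X₂ Y M₁ M₂ N) :
    Stopped C.T.time C.decoded := by
  intro y y' h
  have hT := C.T.isStop y y' h
  have key : ∀ (t t' : ℕ) (ht : t ≤ N) (ht' : t' ≤ N), t = t' → Agree t y y' →
      C.dec t (Fin.take t ht y) = C.dec t' (Fin.take t' ht' y') := by
    rintro t _ ht ht' rfl hag
    congr 1
    funext i
    exact hag _ i.2
  exact key _ _ _ _ hT h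

end Stop

/-! ### The law of the inputs and outputs of a code -/

section Law

variable {X₁ X₂ Y : Type*} {M₁ M₂ N : ℕ}

/-- The channel seen by the message pair `(a, b)`. -/
noncomputable def VLC.kernel (Q : X₁ → X₂ → PMF Y) (C : VLC X₁ X₂ Y M₁ M₂ N) (a : Fin M₁)
    (b : Fin M₂) (k : Fin N) (y : Fin N → Y) : ℝ :=
  (Q (C.enc₁ k a (past k y)) (C.enc₂ k b (past k y)) (y k)).toReal

/-- The inputs and outputs of the channel. -/
def VLC.path (C : VLC X₁ X₂ Y M₁ M₂ N) (a : Fin M₁) (b : Fin M₂) (y : Fin N → Y) :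
    Paths X₁ X₂ Y N :=
  (fun k => C.enc₁ k a (past k y), fun k => C.enc₂ k b (past k y), y)

lemma VLC.law_eq (Q : X₁ → X₂ → PMF Y) (C : VLC X₁ X₂ Y M₁ M₂ N) (a : Fin M₁) (b : Fin M₂)
    (y : Fin N → Y) : C.law Q a b y = ((M₁ : ℝ) * M₂)⁻¹ * ∏ k, C.kernel Q a b k y := by
  rw [VLC.law, one_div, one_div, mul_inv]
  rfl

lemma sum_pmf_toReal {α : Type*} [Fintype α] (p : PMF α) : ∑ a, (p a).toReal = 1 := by
  rw [← ENNReal.toReal_sum fun a _ => p.apply_ne_top a, ← tsum_fintype (L := .unconditional _),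
    p.tsum_coe, ENNReal.toReal_one]

variable [Fintype Y] [DecidableEq Y]

lemma VLC.isKernel (Q : X₁ → X₂ → PMF Y) (C : VLC X₁ X₂ Y M₁ M₂ N) (a : Fin M₁) (b : Fin M₂) :
    IsKernel (C.kernel Q a b) where
  nonneg _ _ := ENNReal.toReal_nonneg
  adapted k y y' h := by
    rw [VLC.kernel, VLC.kernel, past_eq_iff.2 (h.mono (Nat.le_succ _)), h k (Nat.lt_succ_self _)]
  sum_eq k y := by
    have h1 : ∀ a, past k (Function.update y k a) = past k y := fun a =>
      (past_eq_iff.2 (agree_update k y a)).symm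
    simp only [VLC.kernel, h1, Function.update_self]
    exact sum_pmf_toReal _

open Classical in
/-- The input process of an encoder with a uniform message is a causal random process. -/
lemma exists_input_kernel {X : Type*} {M : ℕ} (hM : 0 < M)
    (e : (k : Fin N) → Fin M → (Fin k → Y) → X) :
    ∃ K : (k : Fin N) → (Fin k → X) → (Fin k → Y) → PMF X, ∀ (x : Fin N → X) (y : Fin N → Y),
      ∏ k, (K k (past k x) (past k y) (x k)).toReal =
        ((Finset.univ.filter fun w : Fin M => ∀ k, e k w (past k y) = x k).card : ℝ) / M := by
  -- The messages compatible with the past inputs and outputs. Given these and its own encoder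
  -- alone, the message is uniform on `S`, and the next input is its image; an impossible past gets
  -- an arbitrary point mass.
  let S : (k : Fin N) → (Fin k → X) → (Fin k → Y) → Finset (Fin M) := fun k xs ys =>
    Finset.univ.filter fun w => ∀ i : Fin k,
      e ⟨i, i.2.trans k.2⟩ w (fun j => ys ⟨j, j.2.trans i.2⟩) = xs i
  let K : (k : Fin N) → (Fin k → X) → (Fin k → Y) → PMF X := fun k xs ys =>
    if h : (S k xs ys).Nonempty then (PMF.uniformOfFinset _ h).map (fun w => e k w ys)
    else PMF.pure (e k ⟨0, hM⟩ ys)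
  have hK : ∀ k xs ys a, (S k xs ys).Nonempty → (K k xs ys a).toReal =
      (((S k xs ys).filter fun w => e k w ys = a).card : ℝ) / (S k xs ys).card := by
    intro k xs ys a h
    simp only [K, dif_pos h, PMF.map_apply, tsum_fintype, PMF.uniformOfFinset_apply]
    have h1 : ∑ w, (if a = e k w ys then (if w ∈ S k xs ys then ((S k xs ys).card : ℝ≥0∞)⁻¹ else 0)
        else 0) = ∑ w, if w ∈ (S k xs ys).filter (fun w => e k w ys = a) then
          ((S k xs ys).card : ℝ≥0∞)⁻¹ else 0 := by
      refine Finset.sum_congr rfl fun w _ => ?_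
      by_cases h1 : a = e k w ys <;> by_cases h2 : w ∈ S k xs ys <;>
        simp [h1, h2, Finset.mem_filter, eq_comm]
    trans (∑ w, if w ∈ (S k xs ys).filter (fun w => e k w ys = a) then
          ((S k xs ys).card : ℝ≥0∞)⁻¹ else 0).toReal
    · rw [← h1]
      congr! 4
    rw [Finset.sum_ite_mem, Finset.univ_inter, Finset.sum_const, nsmul_eq_mul, ENNReal.toReal_mul,
      ENNReal.toReal_inv, ENNReal.toReal_natCast, ENNReal.toReal_natCast, div_eq_mul_inv]
  refine ⟨K, fun x y => ?_⟩
  let c : ℕ → Finset (Fin M) := fun n =>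
    Finset.univ.filter fun w => ∀ i : Fin N, (i : ℕ) < n → e i w (past i y) = x i
  have hS : ∀ k : Fin N, S k (past k x) (past k y) = c k := by
    intro k
    refine Finset.filter_congr fun w _ => ⟨fun h i hi => h ⟨i, hi⟩, fun h i => h ⟨i, _⟩ i.2⟩
  have hc : ∀ k : Fin N, c (k + 1) = (c k).filter fun w => e k w (past k y) = x k := by
    intro k
    ext w
    simp only [c, Finset.mem_filter, Finset.mem_univ, true_and]
    constructor
    · exact fun h => ⟨fun i hi => h i (hi.trans (Nat.lt_succ_self _)), h k (Nat.lt_succ_self _)⟩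
    · rintro ⟨h1, h2⟩ i hi
      rcases (Nat.lt_succ_iff.1 hi).lt_or_eq with h | h
      · exact h1 i h
      · rw [Fin.ext h]
        exact h2
  have hMr : (M : ℝ) ≠ 0 := by exact_mod_cast hM.ne'
  -- The factors are `|c (k + 1)| / |c k|`, so the product telescopes. Once `c n` is empty both
  -- sides stay `0`.
  have hind : ∀ n ≤ N, headProd (fun k _ => (K k (past k x) (past k y) (x k)).toReal) n y =
      ((c n).card : ℝ) / M := by
    intro n
    induction n with
    | zero => intro _; simp [headProd_zero, c, hMr]
    | succ n ih =>
      intro hn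
      have h1 := headProd_succ (fun k _ => (K k (past k x) (past k y) (x k)).toReal) ⟨n, hn⟩ y
      simp only at h1
      rw [h1, ih (Nat.le_of_succ_le hn)]
      have h2 : c (n + 1) = _ := hc ⟨n, hn⟩
      have h3 : _ = c n := hS ⟨n, hn⟩
      rcases (c n).eq_empty_or_nonempty with h | h
      · rw [h2, h]
        simp
      · rw [hK _ _ _ _ (h3 ▸ h), h3, ← h2]
        have : ((c n).card : ℝ) ≠ 0 := by exact_mod_cast h.card_pos.ne'
        field_simp
  have := hind N le_rfl
  rw [headProd_last] at this
  rw [this]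
  congr 3
  refine Finset.filter_congr fun w _ => ⟨fun h k => h k k.2, fun h k _ => h k⟩

variable [Fintype X₁] [Fintype X₂] [Nonempty Y]

-- Given `y`, each input sequence is a function of its own message, so the sum over message pairs
-- splits into two counts. These are the two causal input kernels of `exists_input_kernel`, which
-- gives membership in `PMAC`.
open Classical in
lemma VLC.exists_law (Q : X₁ → X₂ → PMF Y) (C : VLC X₁ X₂ Y M₁ M₂ N) :
    ∃ P ∈ PMAC Q N, ∀ F : Paths X₁ X₂ Y N → ℝ, ∑ ω, (P ω).toReal * F ω =
      ((M₁ : ℝ) * M₂)⁻¹ * ∑ a, ∑ b, ∑ y, (∏ k, C.kernel Q a b k y) * F (C.path a b y) := by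
  have hM₁ : (M₁ : ℝ) ≠ 0 := by exact_mod_cast C.M₁_pos.ne'
  have hM₂ : (M₂ : ℝ) ≠ 0 := by exact_mod_cast C.M₂_pos.ne'
  have hnn : ∀ a b y, 0 ≤ ((M₁ : ℝ) * M₂)⁻¹ * ∏ k, C.kernel Q a b k y := fun a b y =>
    mul_nonneg (by positivity) ((C.isKernel Q a b).prod_nonneg y)
  let f : Fin M₁ × Fin M₂ × (Fin N → Y) → ℝ := fun j =>
    ((M₁ : ℝ) * M₂)⁻¹ * ∏ k, C.kernel Q j.1 j.2.1 k j.2.2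
  have hf : ∑ j, ENNReal.ofReal (f j) = 1 := by
    rw [← ENNReal.ofReal_sum_of_nonneg fun j _ => hnn _ _ _, ← ENNReal.ofReal_one]
    congr 1
    simp only [Fintype.sum_prod_type, ← Finset.mul_sum, (C.isKernel Q _ _).sum_prod]
    simp only [Finset.sum_const, Finset.card_univ, Fintype.card_fin, nsmul_eq_mul, mul_one]
    field_simp
  let P : PMF (Paths X₁ X₂ Y N) :=
    (PMF.ofFintype (fun j => ENNReal.ofReal (f j)) hf).map fun j => C.path j.1 j.2.1 j.2.2
  have hPapp : ∀ ω, (P ω).toReal = ∑ j, if ω = C.path j.1 j.2.1 j.2.2 then f j else 0 := by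
    intro ω
    simp only [P, PMF.map_apply, tsum_fintype, PMF.ofFintype_apply]
    rw [ENNReal.toReal_sum]
    · refine Finset.sum_congr rfl fun j _ => ?_
      split_ifs
      · exact ENNReal.toReal_ofReal (hnn _ _ _)
      · rfl
    · intro j _
      split_ifs
      · exact ENNReal.ofReal_ne_top
      · exact ENNReal.zero_ne_top
  have hsum : ∀ F : Paths X₁ X₂ Y N → ℝ, ∑ ω, (P ω).toReal * F ω =
      ((M₁ : ℝ) * M₂)⁻¹ * ∑ a, ∑ b, ∑ y, (∏ k, C.kernel Q a b k y) * F (C.path a b y) := by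
    intro F
    simp only [hPapp, Finset.sum_mul, ite_mul, zero_mul]
    rw [Finset.sum_comm]
    simp only [Finset.sum_ite_eq', Finset.mem_univ, if_true, Fintype.sum_prod_type, f,
      Finset.mul_sum, mul_assoc]
  refine ⟨P, ?_, hsum⟩
  obtain ⟨K₁, hK₁⟩ := exists_input_kernel C.M₁_pos C.enc₁
  obtain ⟨K₂, hK₂⟩ := exists_input_kernel C.M₂_pos C.enc₂
  refine ⟨K₁, K₂, fun x₁ x₂ y => ?_⟩
  rw [← ENNReal.toReal_eq_toReal_iff' (P.apply_ne_top _)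
    (ENNReal.prod_ne_top fun k _ => ENNReal.mul_ne_top
      (ENNReal.mul_ne_top (PMF.apply_ne_top _ _) (PMF.apply_ne_top _ _)) (PMF.apply_ne_top _ _)),
    ENNReal.toReal_prod]
  simp only [ENNReal.toReal_mul, Finset.prod_mul_distrib, hK₁, hK₂]
  have h1 := hsum fun ω => if ω = (x₁, x₂, y) then 1 else 0
  simp only [mul_ite, mul_one, mul_zero, Finset.sum_ite_eq', Finset.mem_univ, if_true] at h1
  rw [h1]
  have h2 : ∀ a b, (∑ y', if C.path a b y' = (x₁, x₂, y) then ∏ k, C.kernel Q a b k y' else 0) =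
      (if ∀ k, C.enc₁ k a (past k y) = x₁ k then 1 else 0) *
        (if ∀ k, C.enc₂ k b (past k y) = x₂ k then 1 else 0) *
        ∏ k, (Q (x₁ k) (x₂ k) (y k)).toReal := by
    intro a b
    rw [Finset.sum_eq_single y]
    · by_cases h3 : ∀ k, C.enc₁ k a (past k y) = x₁ k
      · by_cases h4 : ∀ k, C.enc₂ k b (past k y) = x₂ k
        · have h5 : C.path a b y = (x₁, x₂, y) := by
            simp only [VLC.path, Prod.mk.injEq, and_true]
            exact ⟨funext h3, funext h4⟩
          simp only [h5, if_true, VLC.kernel, h3, h4, implies_true, one_mul]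
        · have h5 : C.path a b y ≠ (x₁, x₂, y) := by
            intro h6
            simp only [VLC.path, Prod.mk.injEq] at h6
            exact h4 (congrFun h6.2.1)
          simp [h5, h4]
      · have h5 : C.path a b y ≠ (x₁, x₂, y) := by
          intro h6
          simp only [VLC.path, Prod.mk.injEq] at h6
          exact h3 (congrFun h6.1)
        simp [h5, h3]
    · intro y' _ hy
      rw [if_neg]
      intro h6
      simp only [VLC.path, Prod.mk.injEq] at h6
      exact hy h6.2.2
    · simp
  simp only [h2]
  rw [Finset.card_filter, Finset.card_filter]
  push_cast
  simp only [← Finset.sum_mul, ← Finset.mul_sum]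
  rw [mul_inv]
  ring

end Law

/-! ### Lower bounds on the two-phase bound -/

section Bound

variable {X₁ X₂ Y : Type*} [Fintype X₁] [Fintype X₂] [Fintype Y] {Q : X₁ → X₂ → PMF Y}

lemma le_twoPhaseBound (hD : Dub Q ≠ ⊤) {R₁ R₂ : ℝ} {N : ℕ} {P : PMF (Paths X₁ X₂ Y N)}
    (hP : P ∈ PMAC Q N) {T : StopTime Y N} {Ti : Fin 3 → StopTime Y N}
    (hle : ∀ i y, (Ti i).time y ≤ T.time y) {x : ℝ} (hx : 0 ≤ x)
    (h : ∀ i, ENNReal.ofReal (rates R₁ R₂ i) ≤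
      ENNReal.ofReal x * ENNReal.ofReal (normInfo P Ti i)) :
    (((Dub Q).toReal * (1 - x) : ℝ) : EReal) ≤ twoPhaseBound Q R₁ R₂ := by
  refine le_trans ?_ (le_iSup_of_le N <| le_iSup_of_le P <| le_iSup_of_le hP <|
    le_iSup_of_le T <| le_iSup_of_le Ti <| le_iSup_of_le hle le_rfl)
  rw [EReal.coe_mul, EReal.coe_ennreal_toReal hD]
  refine mul_le_mul_of_nonneg_left (le_iInf fun i => ?_) (EReal.coe_ennreal_nonneg _)
  rw [EReal.coe_sub, EReal.coe_one]
  refine EReal.sub_le_sub le_rfl ?_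
  calc ((ENNReal.ofReal (rates R₁ R₂ i) / ENNReal.ofReal (normInfo P Ti i) : ℝ≥0∞) : EReal)
      ≤ ((ENNReal.ofReal x : ℝ≥0∞) : EReal) :=
        EReal.coe_ennreal_le_coe_ennreal_iff.2 (ENNReal.div_le_of_le_mul (h i))
    _ = (x : EReal) := by
        rw [EReal.coe_ennreal_ofReal, max_eq_left hx]

/-- `A` stands for the mean length of a code and `τ` for the end of its transmission phase. The
additive rate loss `s` becomes a factor `1 + η`, which only positive rates require; a zero rate
imposes no constraint. -/
lemma le_twoPhaseBound_of_approx (hD : Dub Q ≠ ⊤) {R₁ R₂ : ℝ} {v : ℝ}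
    (H : ∀ s : ℝ, 0 < s → ∃ (N : ℕ) (P : PMF (Paths X₁ X₂ Y N)) (T τ : StopTime Y N) (A : ℝ),
      P ∈ PMAC Q N ∧ (∀ y, τ.time y ≤ T.time y) ∧ 0 < expect P (fun y => (τ.time y : ℝ)) ∧
      expect P (fun y => (τ.time y : ℝ)) ≤ A ∧
      v - s ≤ (Dub Q).toReal * (1 - expect P (fun y => (τ.time y : ℝ)) / A) ∧
      (R₁ - s) * A ≤ directedInfo₁ P τ ∧ (R₂ - s) * A ≤ directedInfo₂ P τ ∧
      (R₁ + R₂ - s) * A ≤ directedInfo₃ P τ) :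
    (v : EReal) ≤ twoPhaseBound Q R₁ R₂ := by
  set D := (Dub Q).toReal with hDdef
  have hD0 : 0 ≤ D := ENNReal.toReal_nonneg
  suffices h : ∀ κ : ℝ, 0 < κ → ((v - κ : ℝ) : EReal) ≤ twoPhaseBound Q R₁ R₂ by
    refine le_of_forall_lt fun c hc => ?_
    obtain ⟨q, hcq, hqv⟩ := EReal.lt_iff_exists_real_btwn.1 hc
    refine hcq.trans_le ?_
    have := h (v - q) (by linarith [EReal.coe_lt_coe_iff.1 hqv])
    simpa using this
  intro κ hκ
  obtain ⟨η, hη, hDη⟩ : ∃ η : ℝ, 0 < η ∧ D * η ≤ κ / 2 :=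
    ⟨κ / (2 * (D + 1)), by positivity, by
      rw [← mul_div_assoc, div_le_div_iff₀ (by positivity) two_pos]
      nlinarith⟩
  have hs : ∀ R : ℝ, ∃ s₀ : ℝ, 0 < s₀ ∧ ∀ s ≤ s₀, 0 < R → R ≤ (1 + η) * (R - s) := by
    intro R
    by_cases hR : 0 < R
    · refine ⟨R * η / (1 + η), by positivity, fun s hs _ => ?_⟩
      rw [le_div_iff₀ (by positivity)] at hs
      linarith
    · exact ⟨1, one_pos, fun _ _ h => absurd h hR⟩
  obtain ⟨s₁, hs₁, h₁⟩ := hs R₁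
  obtain ⟨s₂, hs₂, h₂⟩ := hs R₂
  obtain ⟨s₃, hs₃, h₃⟩ := hs (R₁ + R₂)
  obtain ⟨s, hs0, hsκ, hss₁, hss₂, hss₃⟩ : ∃ s : ℝ, 0 < s ∧ s ≤ κ / 2 ∧ s ≤ s₁ ∧ s ≤ s₂ ∧ s ≤ s₃ :=
    ⟨min (min (κ / 2) s₁) (min s₂ s₃), by positivity,
      (min_le_left _ _).trans (min_le_left _ _), (min_le_left _ _).trans (min_le_right _ _),
      (min_le_right _ _).trans (min_le_left _ _), (min_le_right _ _).trans (min_le_right _ _)⟩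
  obtain ⟨N, P, T, τ, A, hP, hle, hB, hBA, hv, hI₁, hI₂, hI₃⟩ := H s hs0
  set B := expect P (fun y => (τ.time y : ℝ)) with hBdef
  have hA : 0 < A := hB.trans_le hBA
  have hratio : ∀ R I : ℝ, (0 < R → R ≤ (1 + η) * (R - s)) → (R - s) * A ≤ I →
      ENNReal.ofReal R ≤ ENNReal.ofReal (B / A * (1 + η)) * ENNReal.ofReal (I / B) := by
    intro R I hR hI
    rw [← ENNReal.ofReal_mul (by positivity)]
    by_cases hR0 : 0 < R
    · refine ENNReal.ofReal_le_ofReal ((hR hR0).trans ?_)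
      have : B / A * (1 + η) * (I / B) = (1 + η) * (I / A) := by field_simp
      rw [this]
      exact mul_le_mul_of_nonneg_left ((le_div_iff₀ hA).2 hI) (by positivity)
    · rw [ENNReal.ofReal_of_nonpos (not_lt.1 hR0)]
      exact zero_le
  -- All three `T_i` are `τ`. As `B / A ≤ 1`, the factor `1 + η` costs at most `D η ≤ κ / 2`.
  refine le_trans (EReal.coe_le_coe_iff.2 ?_) (le_twoPhaseBound hD hP (T := T) (Ti := fun _ => τ)
    (fun _ => hle) (x := B / A * (1 + η)) (by positivity) ?_)
  · have h4 : B / A ≤ 1 := (div_le_one hA).2 hBA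
    have h5 : D * η * (B / A) ≤ D * η := mul_le_of_le_one_right (by positivity) h4
    rw [← hDdef]
    nlinarith
  · intro i
    fin_cases i
    · exact hratio R₁ _ (h₁ s hss₁) hI₁
    · exact hratio R₂ _ (h₂ s hss₂) hI₂
    · exact hratio (R₁ + R₂) _ (h₃ s hss₃) hI₃

end Bound

/-! ### Bounds for a single code -/

section Code

variable {Y : Type*} [Fintype Y] [DecidableEq Y] {N : ℕ}

-- `wr` only has to dominate the error indicator of `a`, so the error of the pair can bound the
-- error of either component.
open Classical in
lemma fano_average {A B : Type*} [Fintype A] [Fintype B] [Nonempty A] [Nonempty Y]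
    {p : A → B → Fin N → (Fin N → Y) → ℝ} (hp : ∀ a b, IsKernel (p a b)) {est : (Fin N → Y) → A}
    {wr : A → B → (Fin N → Y) → ℝ} (hwr0 : ∀ a b y, 0 ≤ wr a b y)
    (hwr : ∀ a b y, est y ≠ a → 1 ≤ wr a b y) {e θ : ℝ} (hθ : θ ∈ Ioo (0 : ℝ) 1)
    (he : ∑ a, ∑ b, ∑ y, (∏ k, p a b k y) * wr a b y ≤ Fintype.card A * Fintype.card B * e) :
    (Fintype.card A * Fintype.card B : ℝ) *
        ((1 - e) * Real.log (Fintype.card A) + Real.log (1 - θ) + e * Real.log θ) ≤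
      ∑ a, ∑ b, ∑ y, (∏ k, p a b k y) *
        (if est y = a then Real.log ((1 - θ) * Fintype.card A) else Real.log θ) := by
  have hA1 : (1 : ℝ) ≤ Fintype.card A := by exact_mod_cast Fintype.card_pos (α := A)
  set L := Real.log (Fintype.card A) with hL
  have hL0 : 0 ≤ L := Real.log_nonneg hA1
  have hl1 : Real.log (1 - θ) ≤ 0 := Real.log_nonpos (by linarith [hθ.2]) (by linarith [hθ.1])
  have hl2 : Real.log θ ≤ 0 := Real.log_nonpos hθ.1.le hθ.2.le
  have hsplit : Real.log ((1 - θ) * Fintype.card A) = Real.log (1 - θ) + L :=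
    Real.log_mul (by linarith [hθ.2]) (by linarith)
  have hpt : ∀ a b y, (L + Real.log (1 - θ)) * (∏ k, p a b k y) +
      (Real.log θ - L) * ((∏ k, p a b k y) * wr a b y) ≤ (∏ k, p a b k y) *
        (if est y = a then Real.log ((1 - θ) * Fintype.card A) else Real.log θ) := by
    intro a b y
    have h0 := (hp a b).prod_nonneg y
    have h1 : (L + Real.log (1 - θ)) + (Real.log θ - L) * wr a b y ≤
        (if est y = a then Real.log ((1 - θ) * Fintype.card A) else Real.log θ) := by
      rw [hsplit]
      split_ifs with h
      · nlinarith [hwr0 a b y]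
      · nlinarith [hwr a b y h]
    have := mul_le_mul_of_nonneg_left h1 h0
    linarith
  have hsum := Finset.sum_le_sum fun a (_ : a ∈ Finset.univ) =>
    Finset.sum_le_sum fun b (_ : b ∈ Finset.univ) =>
      Finset.sum_le_sum fun y (_ : y ∈ Finset.univ) => hpt a b y
  refine le_trans ?_ hsum
  simp only [Finset.sum_add_distrib, ← Finset.mul_sum, (hp _ _).sum_prod]
  simp only [Finset.sum_const, Finset.card_univ, nsmul_eq_mul, mul_one]
  nlinarith

variable {X₁ X₂ : Type*} {Q : X₁ → X₂ → PMF Y} {M₁ M₂ : ℕ}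

/-- A stopping time of at least `1` forces a transmission, and a row of the channel has nonempty
support. -/
lemma VLC.nonempty_output (Q : X₁ → X₂ → PMF Y) (C : VLC X₁ X₂ Y M₁ M₂ N) : Nonempty Y := by
  by_contra hY
  rw [not_nonempty_iff] at hY
  have hN : 0 < N := by
    rcases Nat.eq_zero_or_pos N with h | h
    · subst h
      have h1 := C.T.one_le (fun i => i.elim0)
      have h2 := C.T.le (fun i => i.elim0)
      omega
    · exact h
  let k : Fin N := ⟨0, hN⟩
  obtain ⟨y, -⟩ := (Q (C.enc₁ k ⟨0, C.M₁_pos⟩ fun i => i.elim0)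
    (C.enc₂ k ⟨0, C.M₂_pos⟩ fun i => i.elim0)).support_nonempty
  exact hY.elim y

open Classical in
/-- The probability that an estimate of the message pair is wrong. -/
noncomputable def VLC.wrongProb (Q : X₁ → X₂ → PMF Y) (C : VLC X₁ X₂ Y M₁ M₂ N)
    (est : (Fin N → Y) → Fin M₁ × Fin M₂) : ℝ :=
  ((M₁ : ℝ) * M₂)⁻¹ * ∑ a, ∑ b, ∑ y, (∏ k, C.kernel Q a b k y) * (if est y = (a, b) then 0 else 1)

lemma VLC.errProb_eq (Q : X₁ → X₂ → PMF Y) (C : VLC X₁ X₂ Y M₁ M₂ N) :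
    C.errProb Q = C.wrongProb Q C.decoded := by
  simp only [VLC.errProb, VLC.wrongProb, Finset.mul_sum, VLC.law_eq]
  refine Finset.sum_congr rfl fun a _ => Finset.sum_congr rfl fun b _ =>
    Finset.sum_congr rfl fun y _ => ?_
  by_cases h : C.decoded y = (a, b) <;> simp [h]

lemma VLC.card_pos (C : VLC X₁ X₂ Y M₁ M₂ N) : (0 : ℝ) < (M₁ : ℝ) * M₂ :=
  mul_pos (by exact_mod_cast C.M₁_pos) (by exact_mod_cast C.M₂_pos)

lemma VLC.one_le_expTime [Nonempty Y] (C : VLC X₁ X₂ Y M₁ M₂ N) : 1 ≤ C.expTime Q := by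
  have hM := C.card_pos
  have h1 : ∑ a, ∑ b, ∑ y, C.law Q a b y = 1 := by
    simp only [VLC.law_eq, ← Finset.mul_sum, (C.isKernel Q _ _).sum_prod]
    simp only [Finset.sum_const, Finset.card_univ, Fintype.card_fin, nsmul_eq_mul, mul_one]
    exact inv_mul_cancel₀ hM.ne'
  rw [← h1, VLC.expTime]
  refine Finset.sum_le_sum fun a _ => Finset.sum_le_sum fun b _ =>
    Finset.sum_le_sum fun y _ => ?_
  refine le_mul_of_one_le_right ?_ (by exact_mod_cast C.T.one_le y)
  rw [VLC.law_eq]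
  exact mul_nonneg (by positivity) ((C.isKernel Q a b).prod_nonneg y)

variable [Fintype X₁] [Fintype X₂] [Nonempty Y]

/-- Three instances of one inequality: estimate the first message given the second, the reverse, and
the pair with trivial side information. -/
lemma VLC.fano (C : VLC X₁ X₂ Y M₁ M₂ N) {P : PMF (Paths X₁ X₂ Y N)}
    (hP : ∀ F : Paths X₁ X₂ Y N → ℝ, ∑ ω, (P ω).toReal * F ω =
      ((M₁ : ℝ) * M₂)⁻¹ * ∑ a, ∑ b, ∑ y, (∏ k, C.kernel Q a b k y) * F (C.path a b y))
    (τ : StopTime Y N) {est : (Fin N → Y) → Fin M₁ × Fin M₂} (hest : Stopped τ.time est)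
    {e θ : ℝ} (he : C.wrongProb Q est ≤ e) (hθ : θ ∈ Ioo (0 : ℝ) 1) :
    (1 - e) * Real.log M₁ + Real.log (1 - θ) + e * Real.log θ ≤
        directedInfo₁ P τ * Real.log 2 ∧
      (1 - e) * Real.log M₂ + Real.log (1 - θ) + e * Real.log θ ≤
        directedInfo₂ P τ * Real.log 2 ∧
      (1 - e) * (Real.log M₁ + Real.log M₂) + Real.log (1 - θ) + e * Real.log θ ≤
        directedInfo₃ P τ * Real.log 2 := by
  classical
  have hM := C.card_pos
  have : Nonempty (Fin M₁) := ⟨⟨0, C.M₁_pos⟩⟩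
  have : Nonempty (Fin M₂) := ⟨⟨0, C.M₂_pos⟩⟩
  have hr1 : ∀ (x₁ : X₁) (x₂ : X₂), ∑ v, (Q x₁ x₂ v).toReal ≤ 1 := fun x₁ x₂ =>
    (sum_pmf_toReal _).le
  have he' : ∑ a, ∑ b, ∑ y, (∏ k, C.kernel Q a b k y) * (if est y = (a, b) then (0 : ℝ) else 1) ≤
      M₁ * M₂ * e := by
    rw [VLC.wrongProb, inv_mul_le_iff₀ hM] at he
    convert he using 9
  have hwr0 : ∀ a b y, (0 : ℝ) ≤ if est y = (a, b) then 0 else 1 := fun a b y => by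
    split_ifs <;> norm_num
  have hz₁ : ∀ (b : Fin M₂) (k : Fin N),
      DependsOnFirst k fun y => upto k fun j => C.enc₂ j b (past j y) := by
    intro b k y y' h
    refine upto_eq_iff.2 fun j hj => ?_
    have : past j y = past j y' := past_eq_iff.2 (h.mono (Nat.lt_succ_iff.1 hj))
    simp only [this]
  have hz₂ : ∀ (a : Fin M₁) (k : Fin N),
      DependsOnFirst k fun y => upto k fun j => C.enc₁ j a (past j y) := by
    intro b k y y' h
    refine upto_eq_iff.2 fun j hj => ?_
    have : past j y = past j y' := past_eq_iff.2 (h.mono (Nat.lt_succ_iff.1 hj))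
    simp only [this]
  refine ⟨?_, ?_, ?_⟩
  · have h1 := fano_directed (fun a b => C.isKernel Q a b) P C.path (fun _ _ _ => rfl)
      (by simpa using hP) τ τ.isStop (fun k ω => upto k ω.1) (fun k ω => upto k ω.2.1)
      (fun k z v => (Q (z.1 (Fin.last k)) (z.2 (Fin.last k)) v).toReal)
      (fun _ _ _ => ENNReal.toReal_nonneg) (fun _ _ => hr1 _ _) (fun _ _ _ _ => rfl)
      (fun b k y => upto k fun j => C.enc₂ j b (past j y)) hz₁ (fun _ _ _ _ => rfl)
      (est := fun y => (est y).1) (fun y y' h => by simp only [hest y y' h]) hθ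
    have h2 := fano_average (fun a b => C.isKernel Q a b) (est := fun y => (est y).1)
      (wr := fun a b y => if est y = (a, b) then 0 else 1) hwr0 (fun a b y h => by
        rw [if_neg]
        rintro h3
        exact h (by rw [h3])) hθ (by simpa using he')
    refine le_trans ?_ h1
    rw [Fintype.card_fin, Fintype.card_fin] at h2 ⊢
    rw [← div_eq_inv_mul, le_div_iff₀ hM, mul_comm]
    exact h2
  · have h1 := fano_directed (fun b a => C.isKernel Q a b) P (fun b a => C.path a b)
      (fun _ _ _ => rfl)
      (by
        intro F
        rw [hP, Finset.sum_comm, Fintype.card_fin, Fintype.card_fin, mul_comm (M₁ : ℝ)])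
      τ τ.isStop (fun k ω => upto k ω.2.1) (fun k ω => upto k ω.1)
      (fun k z v => (Q (z.2 (Fin.last k)) (z.1 (Fin.last k)) v).toReal)
      (fun _ _ _ => ENNReal.toReal_nonneg) (fun _ _ => hr1 _ _) (fun _ _ _ _ => rfl)
      (fun a k y => upto k fun j => C.enc₁ j a (past j y)) hz₂ (fun _ _ _ _ => rfl)
      (est := fun y => (est y).2) (fun y y' h => by simp only [hest y y' h]) hθ
    have h2 := fano_average (fun b a => C.isKernel Q a b) (est := fun y => (est y).2)
      (wr := fun b a y => if est y = (a, b) then 0 else 1) (fun b a => hwr0 a b)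
      (fun b a y h => by
        rw [if_neg]
        rintro h3
        exact h (by rw [h3])) (e := e) hθ (by
          rw [Finset.sum_comm, Fintype.card_fin, Fintype.card_fin, mul_comm (M₂ : ℝ)]
          exact he')
    refine le_trans ?_ h1
    rw [Fintype.card_fin, Fintype.card_fin] at h2 ⊢
    rw [← div_eq_inv_mul, le_div_iff₀ (by rwa [mul_comm]), mul_comm]
    exact h2
  · have h1 := fano_directed (A := Fin M₁ × Fin M₂) (B := Unit)
      (fun w _ => C.isKernel Q w.1 w.2) P (fun w _ => C.path w.1 w.2) (fun _ _ _ => rfl)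
      (by
        intro F
        simp only [hP, Fintype.sum_prod_type, Fintype.card_prod, Fintype.card_fin,
          Fintype.card_unit, Nat.cast_mul, Nat.cast_one, mul_one, Finset.univ_unique,
          Finset.sum_singleton])
      τ τ.isStop (fun k ω => (upto k ω.1, upto k ω.2.1)) (fun _ _ => ())
      (fun k z v => (Q (z.1.1 (Fin.last k)) (z.1.2 (Fin.last k)) v).toReal)
      (fun _ _ _ => ENNReal.toReal_nonneg) (fun _ _ => hr1 _ _) (fun _ _ _ _ => rfl)
      (fun _ _ _ => ()) (fun _ _ _ _ _ => rfl) (fun _ _ _ _ => rfl)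
      (est := est) hest hθ
    have h2 := fano_average (A := Fin M₁ × Fin M₂) (B := Unit)
      (fun w _ => C.isKernel Q w.1 w.2) (est := est)
      (wr := fun w _ y => if est y = w then 0 else 1) (fun w _ y => hwr0 w.1 w.2 y)
      (fun w b y h => by rw [if_neg h]) (e := e) hθ (by
          simpa [Fintype.sum_prod_type] using he')
    refine le_trans ?_ h1
    simp only [Fintype.card_prod, Fintype.card_fin, Fintype.card_unit, Nat.cast_mul, Nat.cast_one,
      mul_one] at h2 ⊢
    rw [← div_eq_inv_mul, le_div_iff₀ hM, mul_comm]
    rwa [Real.log_mul (by exact_mod_cast C.M₁_pos.ne') (by exact_mod_cast C.M₂_pos.ne')] at h2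

/-- A reliable code with many messages takes a long time. -/
lemma VLC.log_card_le (C : VLC X₁ X₂ Y M₁ M₂ N) :
    (1 - C.errProb Q) * (Real.log M₁ + Real.log M₂) - (1 + C.errProb Q) * Real.log 2 ≤
      C.expTime Q * Real.log (Fintype.card Y) := by
  classical
  have hM := C.card_pos
  have : Nonempty (Fin M₁) := ⟨⟨0, C.M₁_pos⟩⟩
  have : Nonempty (Fin M₂) := ⟨⟨0, C.M₂_pos⟩⟩
  have hY : (1 : ℝ) ≤ Fintype.card Y := by exact_mod_cast Fintype.card_pos (α := Y)
  have hθ : (1 / 2 : ℝ) ∈ Ioo (0 : ℝ) 1 := by constructor <;> norm_num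
  -- Against a uniform reference each output carries at most `log |Y|` nats.
  have hq : IsKernel (fun (_ : Fin N) (_ : Fin N → Y) => (Fintype.card Y : ℝ)⁻¹) :=
    { nonneg := fun _ _ => by positivity
      adapted := fun _ _ _ _ => rfl
      sum_eq := fun _ _ => by simp }
  have h1 := fano_stopped (A := Fin M₁ × Fin M₂) (B := Unit) (fun w _ => C.isKernel Q w.1 w.2)
    (fun _ => hq) (fun _ _ _ _ _ => by positivity) C.T.isStop C.T.le C.stopped_decoded hθ
  have h2 := fano_average (A := Fin M₁ × Fin M₂) (B := Unit)
      (fun w _ => C.isKernel Q w.1 w.2) (est := C.decoded)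
      (wr := fun w _ y => if C.decoded y = w then 0 else 1)
      (fun w _ y => by split_ifs <;> norm_num)
      (fun w b y h => by rw [if_neg h]) (e := C.errProb Q) hθ (by
          rw [VLC.errProb_eq, VLC.wrongProb]
          simp only [Fintype.sum_prod_type, Fintype.card_prod, Fintype.card_fin,
            Fintype.card_unit, Nat.cast_mul, Nat.cast_one, mul_one, Finset.univ_unique,
            Finset.sum_singleton, mul_inv_cancel_left₀ hM.ne']
          refine le_of_eq ?_
          congr!)
  have h3 := h2.trans h1
  simp only [Fintype.sum_prod_type, Fintype.card_prod, Fintype.card_fin,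
    Fintype.card_unit, Nat.cast_mul, Nat.cast_one, mul_one, Finset.univ_unique,
    Finset.sum_singleton] at h3
  rw [Real.log_mul (by exact_mod_cast C.M₁_pos.ne') (by exact_mod_cast C.M₂_pos.ne')] at h3
  have h4 : ∑ a, ∑ b, ∑ y, (∏ k, C.kernel Q a b k y) * ∑ k : Fin N,
      (if (k : ℕ) < C.T.time y then
        Real.log (C.kernel Q a b k y / (Fintype.card Y : ℝ)⁻¹) else 0) ≤
      M₁ * M₂ * (C.expTime Q * Real.log (Fintype.card Y)) := by
    rw [VLC.expTime]
    simp only [VLC.law_eq, Finset.mul_sum, Finset.sum_mul]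
    refine Finset.sum_le_sum fun a _ => Finset.sum_le_sum fun b _ =>
      Finset.sum_le_sum fun y _ => ?_
    rw [← Finset.mul_sum]
    have h5 : ∑ k : Fin N, (if (k : ℕ) < C.T.time y then
        Real.log (C.kernel Q a b k y / (Fintype.card Y : ℝ)⁻¹) else 0) ≤
        C.T.time y * Real.log (Fintype.card Y) := by
      have h6 := sum_ite_telescope (fun n => (n : ℝ) * Real.log (Fintype.card Y))
        (Nat.zero_le _) (C.T.le y)
      simp only [Nat.cast_zero, zero_mul, sub_zero] at h6
      rw [← h6]
      refine Finset.sum_le_sum fun k _ => ?_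
      simp only [Nat.zero_le, true_and]
      split_ifs
      · have h7 : C.kernel Q a b k y ≤ 1 := by
          rw [VLC.kernel]
          simpa using ENNReal.toReal_mono ENNReal.one_ne_top (PMF.coe_le_one _ _)
        have h8 : 0 ≤ C.kernel Q a b k y := (C.isKernel Q a b).nonneg k y
        have h9 : Real.log (C.kernel Q a b k y / (Fintype.card Y : ℝ)⁻¹) ≤
            Real.log (Fintype.card Y) := by
          rcases h8.eq_or_lt with h0 | h0
          · rw [← h0]
            simpa using Real.log_nonneg hY
          · refine Real.log_le_log (by positivity) ?_
            rw [div_inv_eq_mul]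
            exact mul_le_of_le_one_left (by positivity) h7
        push_cast
        linarith
      · exact le_rfl
    refine (mul_le_mul_of_nonneg_left h5 ((C.isKernel Q a b).prod_nonneg y)).trans (le_of_eq ?_)
    have := (left_ne_zero_of_mul hM.ne' : (M₁ : ℝ) ≠ 0)
    have := (right_ne_zero_of_mul hM.ne' : (M₂ : ℝ) ≠ 0)
    field_simp
  have h10 := h3.trans h4
  have h11 := le_of_mul_le_mul_left h10 hM
  have h12 : Real.log (1 / 2) = -Real.log 2 := by rw [one_div, Real.log_inv]
  have h13 : (1 : ℝ) - 1 / 2 = 1 / 2 := by norm_num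
  rw [h13, h12] at h11
  linarith

/-- Positivity of the error excludes the infinite exponent: all rows share a support and there are
at least two message pairs, so a wrong decision always has positive probability. -/
lemma VLC.two_phase (hD : Dub Q ≠ ⊤) {lam : ℝ} (hlam : 0 < lam)
    (hratio : ∀ x₁ x₁' x₂ x₂' a, lam * (Q x₁ x₂ a).toReal ≤ (Q x₁' x₂' a).toReal)
    (C : VLC X₁ X₂ Y M₁ M₂ N) (hM₁ : 2 ≤ M₁) {δ : ℝ} (hδ : 0 < δ) (hδ2 : δ ≤ 1 / 2) :
    0 < C.errProb Q ∧ ∃ P ∈ PMAC Q N, ∃ τ : StopTime Y N, (∀ y, τ.time y ≤ C.T.time y) ∧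
      0 < expect P (fun y => (τ.time y : ℝ)) ∧
      expect P (fun y => (τ.time y : ℝ)) ≤ C.expTime Q ∧
      Real.log (C.errProb Q)⁻¹ * (1 - δ - 2 * C.errProb Q) - 2 / (lam * δ) ≤
        (Dub Q).toReal * Real.log 2 * (C.expTime Q - expect P (fun y => (τ.time y : ℝ))) ∧
      (1 - (δ + C.errProb Q)) * Real.log M₁ - (1 + (δ + C.errProb Q)) * Real.log 2 ≤
        directedInfo₁ P τ * Real.log 2 ∧
      (1 - (δ + C.errProb Q)) * Real.log M₂ - (1 + (δ + C.errProb Q)) * Real.log 2 ≤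
        directedInfo₂ P τ * Real.log 2 ∧
      (1 - (δ + C.errProb Q)) * (Real.log M₁ + Real.log M₂) -
          (1 + (δ + C.errProb Q)) * Real.log 2 ≤
        directedInfo₃ P τ * Real.log 2 := by
  classical
  have hM := C.card_pos
  have : Nonempty (Fin M₁) := ⟨⟨0, C.M₁_pos⟩⟩
  have : Nonempty (Fin M₂) := ⟨⟨0, C.M₂_pos⟩⟩
  have : Nontrivial (Fin M₁) := Fin.nontrivial_iff_two_le.2 hM₁
  set W := Fin M₁ × Fin M₂
  let c : W → Fin N → (Fin N → Y) → ℝ := fun w => C.kernel Q w.1 w.2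
  have hc : ∀ w, IsKernel (c w) := fun w => C.isKernel Q w.1 w.2
  have hcard : (Fintype.card W : ℝ) = M₁ * M₂ := by simp [W]
  have hcard2 : 2 ≤ Fintype.card W := by
    simp only [W, Fintype.card_prod, Fintype.card_fin]
    nlinarith [C.M₂_pos]
  have hwrong : ∀ est : (Fin N → Y) → W,
      ∑ w, ∑ y, (∏ k, c w k y) * (if est y = w then (0 : ℝ) else 1) =
        Fintype.card W * C.wrongProb Q est := by
    intro est
    rw [hcard, VLC.wrongProb, mul_inv_cancel_left₀ hM.ne', Fintype.sum_prod_type]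
  have hcr : ∀ w w' k y, lam * c w k y ≤ c w' k y := fun w w' k y => hratio _ _ _ _ _
  set Pe := C.errProb Q with hPedef
  have hPe_eq := hwrong C.decoded
  rw [← VLC.errProb_eq, ← hPedef] at hPe_eq
  have htot : ∑ w, ∑ y, ∏ k, c w k y = (Fintype.card W : ℝ) := by
    simp only [(hc _).sum_prod]
    simp
  have hcardpos : (0 : ℝ) < Fintype.card W := by rw [hcard]; exact hM
  have hPe : 0 < Pe := by
    have h0 : 0 < ∑ w, ∑ y, (∏ k, c w k y) * (if C.decoded y = w then (0 : ℝ) else 1) := by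
      obtain ⟨y, -, hy⟩ : ∃ y ∈ (Finset.univ : Finset (Fin N → Y)),
          0 < ∏ k, c (Classical.arbitrary W) k y := by
        refine Finset.exists_lt_of_sum_lt (f := fun _ => (0 : ℝ)) ?_
        rw [(hc _).sum_prod]
        simp
      obtain ⟨w, hw⟩ := exists_ne (C.decoded y)
      have hnn : ∀ w y, 0 ≤ (∏ k, c w k y) * (if C.decoded y = w then (0 : ℝ) else 1) :=
        fun w y => mul_nonneg ((hc w).prod_nonneg y) (by split_ifs <;> norm_num)
      refine Finset.sum_pos' (fun w _ => Finset.sum_nonneg fun y _ => hnn w y)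
        ⟨w, Finset.mem_univ _, Finset.sum_pos' (fun y _ => hnn w y) ⟨y, Finset.mem_univ _, ?_⟩⟩
      rw [if_neg hw.symm, mul_one]
      refine Finset.prod_pos fun k _ => lt_of_lt_of_le (mul_pos hlam ?_) (hcr (Classical.arbitrary W) w k y)
      exact lt_of_le_of_ne ((hc _).nonneg k y) fun hk =>
        hy.ne' (Finset.prod_eq_zero (Finset.mem_univ k) hk.symm)
    rw [hPe_eq] at h0
    exact (mul_pos_iff_of_pos_left hcardpos).1 h0
  have hPe1 : Pe ≤ 1 := by
    have : (Fintype.card W : ℝ) * Pe ≤ Fintype.card W := by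
      rw [← hPe_eq, ← htot]
      refine Finset.sum_le_sum fun w _ => Finset.sum_le_sum fun y _ =>
        mul_le_of_le_one_right ((hc w).prod_nonneg y) (by split_ifs <;> norm_num)
    exact (mul_le_iff_le_one_right hcardpos).1 this
  refine ⟨hPe, ?_⟩
  obtain ⟨P, hP, hPF⟩ := C.exists_law Q
  obtain ⟨τ, est, hτ, hτ1, hτT, hest, hgood, hrest⟩ :=
    exists_transmission_phase hcard2 hc hlam hcr C.T.isStop C.T.one_le C.T.le hδ hδ2
  have herr := estimate_error_le hc hτ C.T.isStop hτT C.T.le hest C.stopped_decoded hδ.le hgood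
  rw [hwrong, hPe_eq] at herr
  have herr' : C.wrongProb Q est ≤ δ + Pe := by
    refine le_of_mul_le_mul_left ?_ hcardpos
    linarith
  let τ' : StopTime Y N := hτ.toStopTime hτ1 fun y => (hτT y).trans (C.T.le y)
  have hexp : ∀ f : (Fin N → Y) → ℝ, (Fintype.card W : ℝ) * expect P f =
      ∑ w, ∑ y, (∏ k, c w k y) * f y := by
    intro f
    rw [expect, hPF fun ω => f ω.2.2, hcard, mul_inv_cancel_left₀ hM.ne', Fintype.sum_prod_type]
    rfl
  have hA : expect P (fun y => (C.T.time y : ℝ)) = C.expTime Q := by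
    rw [expect, hPF fun ω => (C.T.time ω.2.2 : ℝ), VLC.expTime]
    simp only [VLC.law_eq, Finset.mul_sum, mul_assoc]
    rfl
  have hmono : ∀ f g : (Fin N → Y) → ℝ, (∀ y, f y ≤ g y) → expect P f ≤ expect P g :=
    fun f g h => Finset.sum_le_sum fun ω _ =>
      mul_le_mul_of_nonneg_left (h _) ENNReal.toReal_nonneg
  have hone : expect P (fun _ => 1) = 1 := by simp [expect, sum_pmf_toReal]
  have hθ : (1 / 2 : ℝ) ∈ Ioo (0 : ℝ) 1 := by constructor <;> norm_num
  obtain ⟨hF₁, hF₂, hF₃⟩ := C.fano hPF τ' (est := est) hest herr' hθ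
  have h12 : Real.log (1 / 2) = -Real.log 2 := by rw [one_div, Real.log_inv]
  have h13 : (1 : ℝ) - 1 / 2 = 1 / 2 := by norm_num
  rw [h13, h12] at hF₁ hF₂ hF₃
  refine ⟨P, hP, τ', hτT, ?_, ?_, ?_, by linarith, by linarith, by linarith⟩
  · refine one_pos.trans_le (hone ▸ hmono _ _ fun y => ?_)
    exact_mod_cast hτ1 y
  · rw [← hA]
    exact hmono _ _ fun y => by exact_mod_cast hτT y
  · have hDk : ∀ w w' (k : Fin N) y, ∑ a, c w k (Function.update y k a) *
        Real.log (c w k (Function.update y k a) / c w' k (Function.update y k a)) ≤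
        (Dub Q).toReal * Real.log 2 := by
      intro w w' k y
      have h1 : ∀ a, past k (Function.update y k a) = past k y := fun a =>
        (past_eq_iff.2 (agree_update k y a)).symm
      simp only [c, VLC.kernel, h1, Function.update_self]
      exact sum_log_div_le_Dub hD _ _ _ _
    have hconf := confirmation_phase_le hc hlam hcr
      (mul_nonneg ENNReal.toReal_nonneg (Real.log_pos one_lt_two).le) hDk hτ C.T.isStop hτT C.T.le
      hest C.stopped_decoded (mul_pos hlam hδ) hrest hPe hPe_eq
    rw [← hexp] at hconf
    have hsub : expect P (fun y => (C.T.time y : ℝ) - τ y) =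
        C.expTime Q - expect P (fun y => (τ y : ℝ)) := by
      rw [← hA]
      simp only [expect, mul_sub, Finset.sum_sub_distrib]
    rw [hsub] at hconf
    -- Union bound over the errors at `τ` (at most `δ + Pe`) and at `T` (equal to `Pe`).
    have hboth : (Fintype.card W : ℝ) * (1 - δ - 2 * Pe) ≤
        ∑ w, ∑ y, (∏ k, c w k y) * (if est y = w ∧ C.decoded y = w then (1 : ℝ) else 0) := by
      have h1 : ∀ w y, (∏ k, c w k y) - (∏ k, c w k y) * (if est y = w then (0 : ℝ) else 1) -
          (∏ k, c w k y) * (if C.decoded y = w then (0 : ℝ) else 1) ≤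
          (∏ k, c w k y) * (if est y = w ∧ C.decoded y = w then (1 : ℝ) else 0) := by
        intro w y
        have h0 := (hc w).prod_nonneg y
        by_cases h2 : est y = w <;> by_cases h3 : C.decoded y = w <;> simp [h2, h3, h0]
      have h2 := Finset.sum_le_sum fun w (_ : w ∈ Finset.univ) =>
        Finset.sum_le_sum fun y (_ : y ∈ Finset.univ) => h1 w y
      simp only [Finset.sum_sub_distrib] at h2
      rw [htot, hwrong est, hPe_eq] at h2
      nlinarith [mul_le_mul_of_nonneg_left herr' hcardpos.le]
    have hlogPe : 0 ≤ Real.log Pe⁻¹ := Real.log_nonneg ((one_le_inv₀ hPe).2 hPe1)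
    have h5 := mul_le_mul_of_nonneg_left hboth hlogPe
    refine le_of_mul_le_mul_left ?_ hcardpos
    have h6 : (Fintype.card W : ℝ) * (2 / (lam * δ)) = 2 * Fintype.card W / (lam * δ) := by ring
    change _ ≤ (Fintype.card W : ℝ) * ((Dub Q).toReal * Real.log 2 *
      (C.expTime Q - expect P (fun y => (τ y : ℝ))))
    linarith

end Code

/-! ### The converse -/

section Converse

variable {X₁ X₂ Y : Type*} [Fintype X₁] [Fintype X₂] [Fintype Y] {Q : X₁ → X₂ → PMF Y}

lemma log_ge_of_rate {A r : ℝ} {M : ℕ} (hA : 0 < A)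
    (h : r ≤ Real.logb 2 M / A) : r * A * Real.log 2 ≤ Real.log M := by
  have h1 := (le_div_iff₀ hA).1 h
  rwa [Real.logb, le_div_iff₀ (Real.log_pos one_lt_two)] at h1

lemma half_le_log_two : (1 / 2 : ℝ) ≤ Real.log 2 := by
  linarith [Real.log_two_gt_d9]

/-- With `τ = T` there is no confirmation phase and `1 - B / A = 0`, so only the Fano part is
needed. -/
lemma twoPhaseBound_nonneg (hD : Dub Q ≠ ⊤) {R₁ R₂ : ℝ} (hR₁ : 0 ≤ R₁) (hR₂ : 0 ≤ R₂)
    (h : RateAchievable Q R₁ R₂) : 0 ≤ twoPhaseBound Q R₁ R₂ := by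
  classical
  have hl2 := half_le_log_two
  refine le_twoPhaseBound_of_approx hD (v := 0) fun s hs => ?_
  obtain ⟨m, hm⟩ := h
  -- Only `A ≥ 1` is known here, so a constant Fano correction could not be absorbed. Taking `θ = ε`
  -- makes the correction itself vanish.
  have hcont : ContinuousAt (fun x : ℝ => Real.log (1 - x) + x * Real.log x) 0 := by
    refine ContinuousAt.add ?_ Real.continuous_mul_log.continuousAt
    refine ContinuousAt.log (by fun_prop) (by norm_num)
  have hev := hcont.eventually (lt_mem_nhds (a := -(s / 4)) (by simp; positivity))
  obtain ⟨d, hd, hd'⟩ := Metric.eventually_nhds_iff.1 hev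
  obtain ⟨ε, hε, hεd, hε1, hεs⟩ : ∃ ε : ℝ, 0 < ε ∧ ε < d ∧ ε ≤ 1 / 2 ∧
      ε ≤ s / (2 * (2 + (R₁ + R₂))) :=
    ⟨min (d / 2) (min (1 / 2) (s / (2 * (2 + (R₁ + R₂))))), by positivity,
      (min_le_left _ _).trans_lt (by linarith), (min_le_right _ _).trans (min_le_left _ _),
      (min_le_right _ _).trans (min_le_right _ _)⟩
  have hsmall : -(s / 4) < Real.log (1 - ε) + ε * Real.log ε :=
    hd' (by simpa [abs_of_pos hε] using hεd)
  rw [le_div_iff₀ (by positivity)] at hεs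
  obtain ⟨n₀, hn₀⟩ := hm ε ⟨hε, by linarith⟩
  obtain ⟨M₁, M₂, N, C, hPe, hr₁, hr₂, -⟩ := hn₀ n₀ le_rfl
  have : Nonempty Y := C.nonempty_output Q
  obtain ⟨P, hP, hPF⟩ := C.exists_law Q
  have hA : expect P (fun y => (C.T.time y : ℝ)) = C.expTime Q := by
    rw [expect, hPF fun ω => (C.T.time ω.2.2 : ℝ), VLC.expTime]
    simp only [VLC.law_eq, Finset.mul_sum, mul_assoc]
    rfl
  have hA1 : 1 ≤ C.expTime Q := C.one_le_expTime
  set A := C.expTime Q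
  have hA0 : 0 < A := by linarith
  rw [VLC.errProb_eq] at hPe
  obtain ⟨hF₁, hF₂, hF₃⟩ := C.fano hPF C.T C.stopped_decoded hPe ⟨hε, by linarith⟩
  have hL₁ := log_ge_of_rate hA0 hr₁
  have hL₂ := log_ge_of_rate hA0 hr₂
  have key : ∀ R L I : ℝ, 0 ≤ R → R ≤ R₁ + R₂ → (R - 2 * ε) * A * Real.log 2 ≤ L →
      (1 - ε) * L + Real.log (1 - ε) + ε * Real.log ε ≤ I * Real.log 2 → (R - s) * A ≤ I := by
    intro R L I hR hRle hL hI
    have h1 := mul_le_mul_of_nonneg_left hL (by linarith : (0 : ℝ) ≤ 1 - ε)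
    have h2 : (1 - ε) * ((R - 2 * ε) * A * Real.log 2) - s / 4 ≤ I * Real.log 2 := by linarith
    have h3 : R - s / 2 ≤ (1 - ε) * (R - 2 * ε) := by nlinarith
    have h4 : (R - s / 2) * (A * Real.log 2) ≤ (1 - ε) * (R - 2 * ε) * (A * Real.log 2) :=
      mul_le_mul_of_nonneg_right h3 (by positivity)
    have h5 : s / 4 ≤ s / 2 * (A * Real.log 2) := by
      have : 1 / 2 ≤ A * Real.log 2 := by nlinarith
      nlinarith
    have h6 : (R - s) * A * Real.log 2 ≤ I * Real.log 2 := by linarith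
    exact le_of_mul_le_mul_right h6 (by linarith)
  have hAl : 0 < A * Real.log 2 := by positivity
  have hεl := mul_pos hε hAl
  refine ⟨N, P, C.T, C.T, A, hP, fun _ => le_rfl, by rw [hA]; exact hA0, hA.le, ?_,
    key R₁ _ _ hR₁ (by linarith) (by linarith) hF₁,
    key R₂ _ _ hR₂ (by linarith) (by linarith) hF₂,
    key (R₁ + R₂) _ _ (by linarith) le_rfl (by linarith) hF₃⟩
  rw [hA, div_self hA0.ne']
  linarith

lemma le_twoPhaseBound_of_achievable (hD : Dub Q ≠ ⊤) {E R₁ R₂ : ℝ} (hE : 0 < E) (hR₁ : 0 ≤ R₁)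
    (hR₂ : 0 ≤ R₂) (h : Achievable Q E R₁ R₂) : (E : EReal) ≤ twoPhaseBound Q R₁ R₂ := by
  classical
  have hl2 := half_le_log_two
  have hl20 : 0 < Real.log 2 := by linarith
  refine le_twoPhaseBound_of_approx hD fun s hs => ?_
  obtain ⟨m, hm⟩ := h
  obtain ⟨lam, hlam, hratio⟩ := exists_ratio_bound hD
  -- The last two bounds give `(E - ε)(1 - 3ε) - 2ε ≥ E - s` and `(1 - 2ε)(R - 2ε) - ε ≥ R - s`. The
  -- loss `2ε` in `R` is that of the sum rate.
  obtain ⟨ε, hε, hε6, hεE, hεs₁, hεs₂⟩ : ∃ ε : ℝ, 0 < ε ∧ ε ≤ 1 / 6 ∧ ε ≤ E / 2 ∧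
      ε ≤ s / (3 + 3 * E) ∧ ε ≤ s / (6 + 2 * (R₁ + R₂)) :=
    ⟨min (min (1 / 6) (E / 2)) (min (s / (3 + 3 * E)) (s / (6 + 2 * (R₁ + R₂)))), by positivity,
      (min_le_left _ _).trans (min_le_left _ _), (min_le_left _ _).trans (min_le_right _ _),
      (min_le_right _ _).trans (min_le_left _ _), (min_le_right _ _).trans (min_le_right _ _)⟩
  rw [le_div_iff₀ (by positivity)] at hεs₁ hεs₂
  -- Once `A > K`, the constants of both phases are at most `ε A` and the error probability is at
  -- most `ε`.
  obtain ⟨K, hK₁, hK₂, hK₃⟩ : ∃ K : ℝ, 2 / (lam * ε) ≤ ε * K ∧ 2 ≤ ε * K ∧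
      -Real.log ε ≤ E / 2 * K * Real.log 2 := by
    refine ⟨max (2 / (lam * ε) / ε) (max (2 / ε) (-Real.log ε / (E / 2 * Real.log 2))), ?_, ?_, ?_⟩
    · rw [← div_le_iff₀' hε]
      exact le_max_left _ _
    · rw [← div_le_iff₀' hε]
      exact (le_max_left _ _).trans (le_max_right _ _)
    · have h1 : -Real.log ε / (E / 2 * Real.log 2) ≤
          max (2 / (lam * ε) / ε) (max (2 / ε) (-Real.log ε / (E / 2 * Real.log 2))) :=
        (le_max_right _ _).trans (le_max_right _ _)
      rw [div_le_iff₀ (by positivity)] at h1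
      linarith
  -- A bound on `Pe` below `1` obtained from `A ≥ 1` alone. It must precede the choice of `M`,
  -- because smallness of `Pe` comes from `A > K`, which itself relies on `M`.
  set ρ := Real.exp (-(E / 2 * Real.log 2)) with hρdef
  have hρ1 : ρ < 1 := by
    rw [hρdef, ← Real.exp_zero, Real.exp_lt_exp, neg_lt_zero]
    positivity
  obtain ⟨M, hM2, hMK⟩ : ∃ M : ℕ, 2 ≤ M ∧
      K * Real.log (Fintype.card Y) + 2 * Real.log 2 < (1 - ρ) * Real.log M := by
    have h1 : Filter.Tendsto (fun n : ℕ => (1 - ρ) * Real.log n) Filter.atTop Filter.atTop :=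
      (Real.tendsto_log_atTop.comp tendsto_natCast_atTop_atTop).const_mul_atTop (by linarith)
    obtain ⟨M, h2, h3⟩ := ((h1.eventually_gt_atTop
      (K * Real.log (Fintype.card Y) + 2 * Real.log 2)).and (Filter.eventually_ge_atTop 2)).exists
    exact ⟨M, h3, h2⟩
  obtain ⟨n₀, hn₀⟩ := hm ε ⟨hε, by linarith⟩ M
  obtain ⟨M₁, M₂, N, C, hEx, hr₁, hr₂, hMM₁, hMM₂, -⟩ := hn₀ n₀ le_rfl
  have : Nonempty Y := C.nonempty_output Q
  obtain ⟨hPe, P, hP, τ, hτ, hB0, hBA, hconf, hI₁, hI₂, hI₃⟩ :=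
    C.two_phase hD hlam hratio (hM2.trans hMM₁) hε (by linarith)
  have hlog := C.log_card_le (Q := Q)
  have hA1 : 1 ≤ C.expTime Q := C.one_le_expTime
  rw [VLC.errExponent, if_neg hPe.ne', EReal.coe_le_coe_iff] at hEx
  have hL₁ := log_ge_of_rate (by linarith) hr₁
  have hL₂ := log_ge_of_rate (by linarith) hr₂
  set A := C.expTime Q with hAdef
  set Pe := C.errProb Q with hPedef
  set B := expect P (fun y => (τ.time y : ℝ)) with hBdef
  have hA0 : 0 < A := by linarith
  have hℓ : (E - ε) * A * Real.log 2 ≤ Real.log Pe⁻¹ := by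
    have h1 := (le_div_iff₀ hA0).1 hEx
    rw [Real.logb, ← neg_div, le_div_iff₀ hl20] at h1
    rwa [Real.log_inv]
  have hPeA : Real.log Pe ≤ -(E / 2 * A * Real.log 2) := by
    rw [Real.log_inv] at hℓ
    have : E / 2 * (A * Real.log 2) ≤ (E - ε) * (A * Real.log 2) :=
      mul_le_mul_of_nonneg_right (by linarith) (by positivity)
    linarith
  have hPeρ : Pe ≤ ρ := by
    rw [← Real.exp_log hPe]
    refine Real.exp_le_exp.2 (hPeA.trans (neg_le_neg ?_))
    have : E / 2 * Real.log 2 * 1 ≤ E / 2 * Real.log 2 * A :=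
      mul_le_mul_of_nonneg_left hA1 (by positivity)
    linarith
  have hlogM : ∀ k : ℕ, M ≤ k → Real.log M ≤ Real.log k := fun k hk =>
    Real.log_le_log (by exact_mod_cast (by omega : 0 < M)) (by exact_mod_cast hk)
  have hlogM0 : 0 ≤ Real.log M := Real.log_natCast_nonneg M
  -- Many messages at error at most `ρ < 1` need a long transmission.
  have hKA : K < A := by
    have hY : 0 ≤ Real.log (Fintype.card Y) := Real.log_natCast_nonneg _
    have h1 : (1 - ρ) * Real.log M ≤ (1 - Pe) * (Real.log M₁ + Real.log M₂) := by
      have h2 := hlogM M₁ hMM₁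
      have h3 := hlogM M₂ hMM₂
      refine mul_le_mul (by linarith) (by linarith) hlogM0 (by linarith)
    have h2 : K * Real.log (Fintype.card Y) < A * Real.log (Fintype.card Y) := by
      have : (1 + Pe) * Real.log 2 ≤ 2 * Real.log 2 :=
        mul_le_mul_of_nonneg_right (by linarith) hl20.le
      linarith
    exact lt_of_mul_lt_mul_right h2 hY
  have hεA : 2 ≤ ε * A := hK₂.trans (mul_le_mul_of_nonneg_left hKA.le hε.le)
  have hPeε : Pe ≤ ε := by
    rw [← Real.log_le_log_iff hPe hε]
    have : E / 2 * K * Real.log 2 ≤ E / 2 * A * Real.log 2 := by gcongr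
    linarith
  have hconf' : (E - s) * (A * Real.log 2) ≤
      (Dub Q).toReal * (1 - B / A) * (A * Real.log 2) := by
    have h1 : (Dub Q).toReal * (1 - B / A) * (A * Real.log 2) =
        (Dub Q).toReal * Real.log 2 * (A - B) := by
      field_simp
    rw [h1]
    refine le_trans ?_ hconf
    have h2 : (E - ε) * A * Real.log 2 * (1 - 3 * ε) ≤ Real.log Pe⁻¹ * (1 - ε - 2 * Pe) := by
      refine mul_le_mul hℓ (by linarith) (by linarith) ?_
      refine le_trans ?_ hℓ
      exact mul_nonneg (mul_nonneg (by linarith) hA0.le) hl20.le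
    have h3 : 2 / (lam * ε) ≤ ε * A := hK₁.trans (mul_le_mul_of_nonneg_left hKA.le hε.le)
    have h4 : ε * A ≤ 2 * ε * (A * Real.log 2) := by
      have : ε * A * 1 ≤ ε * A * (2 * Real.log 2) :=
        mul_le_mul_of_nonneg_left (by linarith) (by positivity)
      linarith
    have h5 : (E - s) * (A * Real.log 2) ≤
        ((E - ε) * (1 - 3 * ε) - 2 * ε) * (A * Real.log 2) :=
      mul_le_mul_of_nonneg_right (by linarith [sq_nonneg ε]) (by positivity)
    linarith
  have key : ∀ R L I : ℝ, 0 ≤ R → R ≤ R₁ + R₂ → 0 ≤ L → (R - 2 * ε) * A * Real.log 2 ≤ L →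
      (1 - (ε + Pe)) * L - (1 + (ε + Pe)) * Real.log 2 ≤ I * Real.log 2 → (R - s) * A ≤ I := by
    intro R L I hR hRle hL0 hL hI
    have h1 : (1 - 2 * ε) * ((R - 2 * ε) * A * Real.log 2) ≤ (1 - (ε + Pe)) * L :=
      (mul_le_mul_of_nonneg_left hL (by linarith)).trans
        (mul_le_mul_of_nonneg_right (by linarith) hL0)
    have h2 : (1 + (ε + Pe)) * Real.log 2 ≤ ε * A * Real.log 2 :=
      mul_le_mul_of_nonneg_right (by linarith) hl20.le
    have hεR : ε * R ≤ ε * (R₁ + R₂) := mul_le_mul_of_nonneg_left hRle hε.le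
    have h3 : (R - s) * (A * Real.log 2) ≤
        ((1 - 2 * ε) * (R - 2 * ε) - ε) * (A * Real.log 2) :=
      mul_le_mul_of_nonneg_right (by linarith [sq_nonneg ε]) (by positivity)
    refine le_of_mul_le_mul_right (a := Real.log 2) ?_ hl20
    linarith
  have hM₁0 : 0 ≤ Real.log M₁ := Real.log_natCast_nonneg _
  have hM₂0 : 0 ≤ Real.log M₂ := Real.log_natCast_nonneg _
  have hAl : 0 < A * Real.log 2 := by positivity
  have hεl := mul_pos hε hAl
  exact ⟨N, P, C.T, τ, A, hP, hτ, hB0, hBA, le_of_mul_le_mul_right hconf' hAl,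
    key R₁ _ _ hR₁ (by linarith) hM₁0 (by linarith) hI₁,
    key R₂ _ _ hR₂ (by linarith) hM₂0 (by linarith) hI₂,
    key (R₁ + R₂) _ _ (by linarith) le_rfl (by linarith) (by linarith) hI₃⟩

end Converse

end MACFeedback

theorem corollary1 {X₁ X₂ Y : Type*} [Fintype X₁] [Fintype X₂] [Fintype Y]
    (Q : X₁ → X₂ → PMF Y) (hD : MACFeedback.Dub Q ≠ ⊤)
    (R₁ R₂ : ℝ) (hR₁ : 0 ≤ R₁) (hR₂ : 0 ≤ R₂)
    (hR : MACFeedback.RateAchievable Q R₁ R₂ ∨ 0 < MACFeedback.reliability Q R₁ R₂) :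
    MACFeedback.reliability Q R₁ R₂ ≤ MACFeedback.twoPhaseBound Q R₁ R₂ := by
  -- The supremum also runs over nonpositive exponents, for which nonnegativity of the bound
  -- suffices.
  have hnonneg : 0 ≤ MACFeedback.twoPhaseBound Q R₁ R₂ := by
    rcases hR with hR | hR
    · exact MACFeedback.twoPhaseBound_nonneg hD hR₁ hR₂ hR
    · simp only [MACFeedback.reliability, lt_iSup_iff] at hR
      obtain ⟨E, hE, hE0⟩ := hR
      exact hE0.le.trans (MACFeedback.le_twoPhaseBound_of_achievable hD
        (EReal.coe_pos.1 hE0) hR₁ hR₂ hE)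
  refine iSup₂_le fun E hE => ?_
  rcases lt_or_ge 0 E with h | h
  · exact MACFeedback.le_twoPhaseBound_of_achievable hD h hR₁ hR₂ hE
  · exact (EReal.coe_nonpos.2 h).trans hnonneg
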